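/- **Theorem (Non-Hermitian hard edge scaling limit).** Let $\rho\in(0,1)$ and let $Q(\zeta)=|\zeta|^2$ for $|\zeta|\le\sqrt2\rho$, $Q(\zeta)=\infty$ otherwise. Let $dA(\zeta)=\frac1\pi d^2\zeta$, and consider the planar symplectic ensemble of $N$ points with joint probability density $$\mathbf P_N(\zeta_1,\dots,\zeta_N)=\frac1{Z_N}\prod_{j>k}|\zeta_j-\zeta_k|^2\,|\zeta_j-\bar\zeta_k|^2\prod_{j=1}^N|\zeta_j-\bar\zeta_j|^2e^{-NQ(\zeta_j)}$$ with respect to $\prod_j dA(\zeta_j)$, where $Z_N$ is the normalising constant. Its $k$-point correlation function is $$\mathbf R_{N,k}(\zeta_1,\dots,\zeta_k)=\frac{N!}{(N-k)!}\int_{\mathbb C^{N-k}}\mathbf P_N(\zeta_1,\dots,\zeta_N)\prod_{j=k+1}^N dA(\zeta_j)\qquad(k\le N).$$ Let $p=\pm\sqrt2\rho$, let $\theta\in\mathbb R$ be the angle of the outward normal to the disk $|\zeta|\le\sqrt2\rho$ at $p$ (so $e^{i\theta}=p/|p|$), and let $\gamma_N=\dfrac{\sqrt2\rho}{N(1-\rho^2)}$.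 Let $$R_{N,k}(z_1,\dots,z_k)=\gamma_N^{2k}\,\mathbf R_{N,k}(\zeta_1,\dots,\zeta_k),\qquad \zeta_j=p+e^{i\theta}\gamma_Nz_j,$$ be the $k$-point correlation function of the rescaled process. Then for every $k$, as $N\to\infty$, $R_{N,k}$ converges, locally uniformly on $\{(z_1,\dots,z_k)\in\mathbb C^k:\operatorname{Re}z_j<0\text{ for all }j\}$, to $$R_k(z_1,\dots,z_k)=\prod_{j=1}^k(\bar z_j-z_j)\,\mathrm{Pf}\left[\begin{pmatrix}\kappa(z_j,z_l)&\kappa(z_j,\bar z_l)\\ \kappa(\bar z_j,z_l)&\kappa(\bar z_j,\bar z_l)\end{pmatrix}\right]_{j,l=1}^k,$$ where the Pfaffian of a $2n\times2n$ skew-symmetric matrix is $\mathrm{Pf}(A)=\frac1{2^nn!}\sum_{\sigma\in S_{2n}}\mathrm{sgn}(\sigma)\prod_{j=1}^na_{\sigma(2j-1),\sigma(2j)}$, and $$\kappa(z,w)=\int_0^1W(f_w,f_z)(u)\,du,\qquad f_z(u)=\int_0^ut^{1/2}e^{2zt}\,dt,\qquad W(f,g)=fg'-gf'.$$ -/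

import Mathlib

noncomputable section

namespace SymplecticEnsemble

open MeasureTheory ComplexConjugate

/-- The area measure `dA(ζ) = d²ζ / π` on the complex plane. -/
def areaMeasure : Measure ℂ := NNReal.pi⁻¹ • volume

/-- The hard edge Ginibre potential: `|ζ|²` on the disk `|ζ| ≤ √2 ρ`, and `∞` elsewhere. -/
def hardEdgePotential (ρ : ℝ) (ζ : ℂ) : EReal :=
  open Classical in if ‖ζ‖ ≤ √2 * ρ then ((‖ζ‖ ^ 2 : ℝ) : EReal) else ⊤

/-- The Boltzmann factor `e^{-N Q(ζ)}`, which is `0` where `Q(ζ) = ∞` (for `N ≥ 1`). -/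
def boltzmann (Q : ℂ → EReal) (N : ℕ) (ζ : ℂ) : ℝ :=
  (EReal.exp (-((N : EReal) * Q ζ))).toReal

/-- The unnormalised joint density of the `N`-particle planar symplectic ensemble:
`∏_{j>k} |ζ_j - ζ_k|² |ζ_j - conj ζ_k|² ∏_j |ζ_j - conj ζ_j|² e^{-N Q(ζ_j)}`. -/
def jointWeight (Q : ℂ → EReal) (N : ℕ) (ζ : Fin N → ℂ) : ℝ :=
  (∏ j : Fin N, ∏ k ∈ Finset.Iio j, ‖ζ j - ζ k‖ ^ 2 * ‖ζ j - conj (ζ k)‖ ^ 2) *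
    ∏ j : Fin N, ‖ζ j - conj (ζ j)‖ ^ 2 * boltzmann Q N (ζ j)

/-- The partition function `Z_N`. -/
def partitionFunction (Q : ℂ → EReal) (N : ℕ) : ℝ :=
  ∫ ζ : Fin N → ℂ, jointWeight Q N ζ ∂(Measure.pi fun _ => areaMeasure)

/-- The joint probability density `P_N` with respect to `∏_j dA(ζ_j)`. -/
def jointDensity (Q : ℂ → EReal) (N : ℕ) (ζ : Fin N → ℂ) : ℝ :=
  jointWeight Q N ζ / partitionFunction Q N

/-- The configuration `(ζ_1, …, ζ_k, η_1, …, η_{N-k})`. -/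
def extendConfig {N k : ℕ} (ζ : Fin k → ℂ) (η : Fin (N - k) → ℂ) (i : Fin N) : ℂ :=
  if h : (i : ℕ) < k then ζ ⟨i, h⟩ else η ⟨(i : ℕ) - k, by omega⟩

/-- The `k`-point correlation function of the (unscaled) ensemble,
`N! / (N-k)! ∫_{ℂ^{N-k}} P_N(ζ_1, …, ζ_N) ∏_{j=k+1}^N dA(ζ_j)`.
The factor `N! / (N-k)!` is the descending factorial (so the value is `0` if `k > N`). -/
def correlation (Q : ℂ → EReal) (N k : ℕ) (ζ : Fin k → ℂ) : ℝ :=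
  (N.descFactorial k : ℝ) *
    ∫ η : Fin (N - k) → ℂ, jointDensity Q N (extendConfig ζ η)
      ∂(Measure.pi fun _ => areaMeasure)

/-- The `k`-point correlation function of the rescaled process
`z_j = e^{-iθ} γ⁻¹ (ζ_j - p)`, again with respect to `dA`. -/
def rescaledCorrelation (Q : ℂ → EReal) (p θ γ : ℝ) (N k : ℕ) (z : Fin k → ℂ) : ℝ :=
  γ ^ (2 * k) *
    correlation Q N k fun j => (p : ℂ) + Complex.exp (θ * Complex.I) * (γ : ℂ) * z j

/-- The micro-scale at the hard edge. -/
def hardEdgeScale (ρ : ℝ) (N : ℕ) : ℝ := √2 * ρ / (N * (1 - ρ ^ 2))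

/-- The Pfaffian `(2ⁿ n!)⁻¹ ∑_σ sgn(σ) ∏_j a_{σ(2j-1), σ(2j)}` of a `2n × 2n` matrix, written as
an `n × n` matrix of `2 × 2` blocks: row `2j-1` is `(j, 0)` and row `2j` is `(j, 1)`. -/
def pfaffian {n : ℕ} (A : Matrix (Fin n × Fin 2) (Fin n × Fin 2) ℂ) : ℂ :=
  (1 / (2 ^ n * (n.factorial : ℂ))) *
    ∑ σ : Equiv.Perm (Fin n × Fin 2),
      ((Equiv.Perm.sign σ : ℤ) : ℂ) * ∏ j : Fin n, A (σ (j, 0)) (σ (j, 1))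

/-- `∏_j (conj z_j - z_j) Pf [ κ(z_j, z_l), κ(z_j, conj z_l); κ(conj z_j, z_l),
κ(conj z_j, conj z_l) ]_{j,l}`. -/
def pfaffianCorrelation (κ : ℂ → ℂ → ℂ) (k : ℕ) (z : Fin k → ℂ) : ℂ :=
  (∏ j : Fin k, (conj (z j) - z j)) *
    pfaffian (Matrix.of fun a b : Fin k × Fin 2 =>
      (!![κ (z a.1) (z b.1), κ (z a.1) (conj (z b.1));
          κ (conj (z a.1)) (z b.1), κ (conj (z a.1)) (conj (z b.1))] :
        Matrix (Fin 2) (Fin 2) ℂ) a.2 b.2)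

/-- The Wronskian `W(f, g) = f g' - g f'`. -/
def wronskian (f g : ℝ → ℂ) (u : ℝ) : ℂ := f u * deriv g u - g u * deriv f u

/-- `f_z(u) = ∫_0^u t^{1/2} e^{2zt} dt`. -/
def hardEdgeFun (z : ℂ) (u : ℝ) : ℂ :=
  ∫ t in (0 : ℝ)..u, (√t : ℂ) * Complex.exp (2 * z * t)

/-- The hard edge pre-kernel `κ(z, w) = ∫_{(0,1)} W(f_w, f_z)(u) du`. -/
def hardEdgeKernel (z w : ℂ) : ℂ :=
  ∫ u in Set.Ioo (0 : ℝ) 1, wronskian (hardEdgeFun w) (hardEdgeFun z) u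

end SymplecticEnsemble

end

/-! The joint weight is the Vandermonde determinant of the `2N` points `ζ_j, conj ζ_j` times the
one-particle factors `(ζ - conj ζ) e^{-NQ}`. Its columns may be taken to be any monic polynomials,
in particular polynomials skew-orthogonal for `∫ P(ζ) Q(conj ζ) (ζ - conj ζ) e^{-NQ} dA`.
Integrating out `N - k` points of the expanded determinant then leaves a Pfaffian of an explicit
kernel (`signedPairSum_eq_pfaffian`, `correlation_eq_pfaffian`). Since the weight is radial,
everything is expressed by the moments `h_j` of the truncated Gaussian: the skew norms are
`h_{2m+1}`, and the even polynomials have products of ratios `h_{2i+2} / h_{2i+1}` as coefficients.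

Put `R = √2 ρ` and `b_j = R^{2j+2} e^{-NR²} / h_j`. Integration by parts and Cauchy-Schwarz give a
recursion, monotonicity and log-concavity for `b`. These alone force `b_j = max(j - NR², 0) +
O(√(j+1))`: only degrees above `NR² = 2ρ²N` feel the wall. Log-concavity also makes the squares of
the kernel coefficients telescope (`edgeCoeff_sq_bounds`), so no asymptotics of incomplete gamma
functions are needed.

At the scale `γ_N` the kernel is a double sum over `l ≤ m < N`. With `m ~ sN`, `l ~ tN` it is a
Riemann sum for `√(2s - 2ρ²) √(2t - 2ρ²) e^{2sξ + 2tη}` over `t < s` (`tendsto_edgeSum`), dominated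
because `Re z < 0` puts the points inside the disk. The substitution `u = (s - ρ²) / (1 - ρ²)` turns
the limit into half of `κ`, times exponentials which the Boltzmann factors cancel
(`integral_edge_eq`, `rescaledCorrelation_eq`). Limits are taken along an arbitrary countably
generated filter, so that `N → ∞` and `z → z₀` can happen simultaneously; this yields local
uniformity. -/

noncomputable section

namespace SymplecticEnsemble

open MeasureTheory ComplexConjugate

/-! ### Pfaffian integration: signed sums over pairings -/

section Algebra

/-- The signed sum over all ways to arrange the indices in ordered pairs. -/
def signedPairSum {n : Type*} [Fintype n] [DecidableEq n]
    (g : n → n × Fin 2 → n × Fin 2 → ℂ) : ℂ :=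
  ∑ σ : Equiv.Perm (n × Fin 2),
    ((Equiv.Perm.sign σ : ℤ) : ℂ) * ∏ j, g j (σ (j, 0)) (σ (j, 1))

variable {n α β : Type*} [Fintype n] [DecidableEq n] [Fintype α] [DecidableEq α]
  [Fintype β] [DecidableEq β]

lemma signedPairSum_update_swap (g : n → n × Fin 2 → n × Fin 2 → ℂ) (i : n) :
    signedPairSum (Function.update g i fun a b => g i b a) = -signedPairSum g := by
  unfold signedPairSum
  rw [← Finset.sum_neg_distrib]
  refine Fintype.sum_equiv (Equiv.mulRight (Equiv.swap (i, 0) (i, 1))) _ _ fun σ => ?_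
  have h : ((i, 0) : n × Fin 2) ≠ (i, 1) := by simp
  simp only [Equiv.coe_mulRight, Equiv.Perm.sign_mul, Equiv.Perm.sign_swap h]
  have : ∀ j, Function.update g i (fun a b => g i b a) j (σ (j, 0)) (σ (j, 1)) =
      g j ((σ * Equiv.swap (i, 0) (i, 1) : Equiv.Perm (n × Fin 2)) (j, 0))
        ((σ * Equiv.swap (i, 0) (i, 1) : Equiv.Perm (n × Fin 2)) (j, 1)) := by
    intro j
    by_cases hj : j = i
    · subst hj; simp
    · rw [Function.update_of_ne hj, Equiv.Perm.mul_apply, Equiv.Perm.mul_apply]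
      rw [Equiv.swap_apply_of_ne_of_ne (by simp [hj]) (by simp),
        Equiv.swap_apply_of_ne_of_ne (by simp) (by simp [hj])]
  simp [this]

/-- Each swap inside a pair changes the sign of the permutation, so antisymmetrising one factor
doubles the sum. -/
lemma signedPairSum_antisymm (g : n → n × Fin 2 → n × Fin 2 → ℂ) (t : Finset n) :
    signedPairSum (fun j a b => if j ∈ t then g j a b - g j b a else g j a b) =
      2 ^ t.card * signedPairSum g := by
  induction t using Finset.induction_on with
  | empty => simp
  | insert i t hi ih =>
    set G : n → n × Fin 2 → n × Fin 2 → ℂ :=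
      fun j a b => if j ∈ t then g j a b - g j b a else g j a b with hG
    have hsplit : signedPairSum
        (fun j a b => if j ∈ insert i t then g j a b - g j b a else g j a b) =
        signedPairSum G - signedPairSum (Function.update G i fun a b => G i b a) := by
      unfold signedPairSum
      rw [← Finset.sum_sub_distrib]
      refine Finset.sum_congr rfl fun σ _ => ?_
      rw [← mul_sub]
      congr 1
      rw [← Finset.mul_prod_erase _ _ (Finset.mem_univ i),
        ← Finset.mul_prod_erase _ (fun j => G j _ _) (Finset.mem_univ i),
        ← Finset.mul_prod_erase _ (fun j => Function.update G i _ j _ _) (Finset.mem_univ i)]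
      have h1 : ∏ j ∈ Finset.univ.erase i, Function.update G i (fun a b => G i b a) j
          (σ (j, 0)) (σ (j, 1)) = ∏ j ∈ Finset.univ.erase i, G j (σ (j, 0)) (σ (j, 1)) :=
        Finset.prod_congr rfl fun j hj => by
          rw [Function.update_of_ne (Finset.ne_of_mem_erase hj)]
      have h2 : ∏ j ∈ Finset.univ.erase i, (if j ∈ insert i t then
          g j (σ (j, 0)) (σ (j, 1)) - g j (σ (j, 1)) (σ (j, 0)) else g j (σ (j, 0)) (σ (j, 1)))
          = ∏ j ∈ Finset.univ.erase i, G j (σ (j, 0)) (σ (j, 1)) :=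
        Finset.prod_congr rfl fun j hj => by
          simp [hG, Finset.mem_insert, Finset.ne_of_mem_erase hj]
      rw [h1, h2, ← sub_mul]
      congr 1
      simp [hG, hi]
    rw [hsplit, signedPairSum_update_swap, ih, Finset.card_insert_of_notMem hi]
    ring

lemma signedPairSum_eq_det (X : n × Fin 2 → n × Fin 2 → ℂ) :
    signedPairSum (fun j a b => X (j, 0) a * X (j, 1) b) = (Matrix.of X).det := by
  rw [← Matrix.det_transpose, Matrix.det_apply']
  unfold signedPairSum
  refine Finset.sum_congr rfl fun σ _ => ?_
  simp [Fintype.prod_prod_type, Fin.prod_univ_two, Matrix.transpose_apply]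

/-- Sums over permutations, of a function of the restriction of the permutation. -/
lemma sum_perm_restrict {ε γ : Type*} [Fintype ε] [Fintype γ] [DecidableEq γ] (s : α ⊕ ε ≃ γ)
    (F : (α → γ) → ℂ) (hF : ∀ f, ¬ Function.Injective f → F f = 0) :
    ∑ τ : Equiv.Perm γ, F (fun d => τ (s (.inl d))) =
      (Fintype.card ε).factorial * ∑ f, F f := by
  have h1 : ∑ f, F f = ∑ e : α ↪ γ, F e := by
    symm
    refine Finset.sum_bij_ne_zero (fun e _ _ => (e : α → γ)) (by simp) ?_ ?_ ?_
    · intro a _ _ b _ _ h; exact DFunLike.coe_injective h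
    · intro f _ hf
      by_cases hi : Function.Injective f
      · exact ⟨⟨f, hi⟩, by simp, hf, rfl⟩
      · exact absurd (hF f hi) hf
    · intros; rfl
  have h2 : ∑ τ : Equiv.Perm γ, F (fun d => τ (s (.inl d))) =
      ∑ e : α ⊕ ε ↪ γ, F (fun d => e (.inl d)) := by
    refine Fintype.sum_bijective
      (fun τ : Equiv.Perm γ => s.toEmbedding.trans τ.toEmbedding) ⟨?_, ?_⟩ _ _ fun τ => rfl
    · intro τ τ' h
      ext x
      have := DFunLike.congr_fun h (s.symm x)
      simpa using this
    · intro e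
      have hb : Function.Bijective (s.symm.toEmbedding.trans e) :=
        Finite.injective_iff_bijective.1 (s.symm.toEmbedding.trans e).injective
      exact ⟨Equiv.ofBijective _ hb, by ext x; simp⟩
  rw [h1, h2, Finset.mul_sum,
    Fintype.sum_equiv Equiv.sumEmbeddingEquivSigmaEmbeddingRestricted
      (fun e : α ⊕ ε ↪ γ => F (fun d => e (.inl d)))
      (fun p : Σ f : α ↪ γ, ε ↪ ↥(Set.range f)ᶜ => F p.1) (fun e => rfl),
    Fintype.sum_sigma]
  refine Finset.sum_congr rfl fun f _ => ?_
  have hc : Fintype.card ↥(Set.range f)ᶜ = Fintype.card ε := by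
    have := Fintype.card_congr s
    rw [Fintype.card_sum] at this
    rw [Fintype.card_compl_set, ← this, Set.card_range_of_injective f.injective]
    omega
  change ∑ _y : ε ↪ ↥(Set.range f)ᶜ, F f = _
  rw [Finset.sum_const, Finset.card_univ, Fintype.card_embedding_eq, hc, Nat.descFactorial_self,
    nsmul_eq_mul]

lemma det_eq_det_of_rows_unit (X : α × Fin 2 → (α ⊕ β) × Fin 2 → ℂ)
    (τ : Equiv.Perm (α ⊕ β)) :
    (Matrix.of fun p : (α ⊕ β) × Fin 2 => Sum.elim
      (fun j (a : (α ⊕ β) × Fin 2) => X (j, p.2) a)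
      (fun j a => if a = (τ (.inr j), p.2) then 1 else 0) p.1).det =
    (Matrix.of fun (p q : α × Fin 2) => X p (τ (.inl q.1), q.2)).det := by
  set M := (Matrix.of fun p : (α ⊕ β) × Fin 2 => Sum.elim
      (fun j (a : (α ⊕ β) × Fin 2) => X (j, p.2) a)
      (fun j a => if a = (τ (.inr j), p.2) then 1 else 0) p.1) with hM
  have h1 : (M.submatrix id (Equiv.prodCongrLeft fun _ : Fin 2 => τ)).det = M.det := by
    -- The permutation moves both members of each pair alike, so its sign is `sign τ` squared.
    rw [Matrix.det_permute', Equiv.Perm.sign_prodCongrLeft]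
    simp
  rw [← h1, ← Matrix.det_submatrix_equiv_self (Equiv.sumProdDistrib α β (Fin 2)).symm]
  have h2 : (M.submatrix id (Equiv.prodCongrLeft fun _ : Fin 2 => τ)).submatrix
      (Equiv.sumProdDistrib α β (Fin 2)).symm (Equiv.sumProdDistrib α β (Fin 2)).symm =
      Matrix.fromBlocks (Matrix.of fun (p q : α × Fin 2) => X p (τ (.inl q.1), q.2))
        (Matrix.of fun (p : α × Fin 2) (q : β × Fin 2) => X p (τ (.inr q.1), q.2)) 0 1 := by
    ext (⟨j, i⟩ | ⟨j, i⟩) (⟨j', i'⟩ | ⟨j', i'⟩)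
    · simp [hM]
    · simp [hM]
    · simp [hM]
    · simp [hM, Matrix.one_apply, Prod.ext_iff, eq_comm]
  rw [h2, Matrix.det_fromBlocks_zero₂₁, Matrix.det_one, mul_one]

/-- Pairing off the indices of `β` against a block diagonal skew form. -/
lemma signedPairSum_block (X : α × Fin 2 → (α ⊕ β) × Fin 2 → ℂ) (r : α ⊕ β → ℂ) :
    (Fintype.card α).factorial * signedPairSum (n := α ⊕ β)
      (Sum.elim (fun j a b => X (j, 0) a * X (j, 1) b)
        (fun _ a b => ∑ m, r m * ((if a = (m, 0) then 1 else 0) *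
          (if b = (m, 1) then 1 else 0)))) =
    ∑ τ : Equiv.Perm (α ⊕ β), (∏ j, r (τ (.inr j))) *
      (Matrix.of fun (p q : α × Fin 2) => X p (τ (.inl q.1), q.2)).det := by
  let M (m : β → α ⊕ β) := (Matrix.of fun p : (α ⊕ β) × Fin 2 => Sum.elim
      (fun j (a : (α ⊕ β) × Fin 2) => X (j, p.2) a)
      (fun j a => if a = (m j, p.2) then 1 else 0) p.1)
  have h1 : signedPairSum (n := α ⊕ β)
      (Sum.elim (fun j a b => X (j, 0) a * X (j, 1) b)
        (fun _ a b => ∑ m, r m * ((if a = (m, 0) then 1 else 0) *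
          (if b = (m, 1) then 1 else 0)))) =
      ∑ m : β → α ⊕ β, (∏ j, r (m j)) * (M m).det := by
    have : ∀ m, (M m).det = signedPairSum (n := α ⊕ β)
      (Sum.elim (fun j a b => X (j, 0) a * X (j, 1) b)
        (fun j a b => (if a = (m j, 0) then 1 else 0) *
          (if b = (m j, 1) then 1 else 0))) := by
      intro m
      rw [← signedPairSum_eq_det]
      congr 1
      funext j
      cases j <;> rfl
    simp only [this]
    unfold signedPairSum
    simp only [Fintype.prod_sum_type, Sum.elim_inl, Sum.elim_inr, Finset.prod_univ_sum,
      Fintype.piFinset_univ, Finset.mul_sum]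
    rw [Finset.sum_comm]
    refine Finset.sum_congr rfl fun m _ => Finset.sum_congr rfl fun σ _ => ?_
    rw [Finset.prod_mul_distrib (f := fun j => r (m j))]
    ring
  rw [h1, ← sum_perm_restrict (Equiv.sumComm β α) (fun m => (∏ j, r (m j)) * (M m).det)]
  · refine Finset.sum_congr rfl fun τ _ => ?_
    rw [← det_eq_det_of_rows_unit]
    rfl
  · intro m hm
    obtain ⟨j, j', h, hne⟩ : ∃ j j', m j = m j' ∧ j ≠ j' := by
      simpa [Function.Injective] using hm
    rw [Matrix.det_zero_of_row_eq (i := (.inr j, 0)) (j := (.inr j', 0)) (by simp [hne]),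
      mul_zero]
    funext a
    change (if a = (m j, 0) then (1 : ℂ) else 0) = if a = (m j', 0) then 1 else 0
    rw [h]

/-- The kernel built from the pairs `(q (m, 0), q (m, 1))` with skew norms `r m`. -/
def skewKernel (q : n × Fin 2 → ℂ → ℂ) (r : n → ℂ) (x y : ℂ) : ℂ :=
  ∑ m, (r m)⁻¹ * (q (m, 0) x * q (m, 1) y - q (m, 0) y * q (m, 1) x)

/-- A Cauchy-Binet expansion: the Pfaffian is a sum of minors indexed by maps `Fin k → Fin k ⊕ β`.
Non-injective maps give repeated rows, and each injective one extends to `(card β)!` permutations.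
This is the form in which it can be compared with `signedPairSum_block`. -/
lemma pfaffian_skewKernel {k : ℕ} (q : (Fin k ⊕ β) × Fin 2 → ℂ → ℂ) (r : Fin k ⊕ β → ℂ)
    (x : Fin k × Fin 2 → ℂ) :
    (k.factorial * (Fintype.card β).factorial : ℂ) *
      pfaffian (Matrix.of fun a b => skewKernel q r (x a) (x b)) =
    ∑ τ : Equiv.Perm (Fin k ⊕ β), (∏ j, (r (τ (.inl j)))⁻¹) *
      (Matrix.of fun (p a : Fin k × Fin 2) => q (τ (.inl a.1), a.2) (x p)).det := by
  let M (m : Fin k → Fin k ⊕ β) :=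
    (Matrix.of fun (a p : Fin k × Fin 2) => q (m a.1, a.2) (x p))
  have h1 : pfaffian (Matrix.of fun a b => skewKernel q r (x a) (x b)) =
      (1 / (2 ^ k * (k.factorial : ℂ))) * (2 ^ k * signedPairSum (n := Fin k)
        (fun j a b => ∑ m, (r m)⁻¹ * (q (m, 0) (x a) * q (m, 1) (x b)))) := by
    have := signedPairSum_antisymm (n := Fin k) (fun j a b => ∑ m, (r m)⁻¹ *
      (q (m, 0) (x a) * q (m, 1) (x b))) Finset.univ
    rw [Finset.card_univ, Fintype.card_fin] at this
    rw [← this, pfaffian, signedPairSum]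
    congr 1
    refine Finset.sum_congr rfl fun σ _ => ?_
    congr 1
    refine Finset.prod_congr rfl fun j _ => ?_
    simp only [Matrix.of_apply, skewKernel, Finset.mem_univ, if_true, mul_sub,
      Finset.sum_sub_distrib]
  have h2 : signedPairSum (n := Fin k)
        (fun j a b => ∑ m, (r m)⁻¹ * (q (m, 0) (x a) * q (m, 1) (x b))) =
      ∑ m : Fin k → Fin k ⊕ β, (∏ j, (r (m j))⁻¹) * (M m).det := by
    have : ∀ m, (M m).det = _ := fun m =>
      (signedPairSum_eq_det (fun (a p : Fin k × Fin 2) => q (m a.1, a.2) (x p))).symm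
    simp only [this]
    unfold signedPairSum
    simp only [Finset.prod_univ_sum, Fintype.piFinset_univ, Finset.mul_sum]
    rw [Finset.sum_comm]
    refine Finset.sum_congr rfl fun m _ => Finset.sum_congr rfl fun σ _ => ?_
    rw [Finset.prod_mul_distrib]
    ring
  have hk : (k.factorial : ℂ) ≠ 0 := by exact_mod_cast k.factorial_ne_zero
  have h3 := sum_perm_restrict (Equiv.refl (Fin k ⊕ β))
    (fun m => (∏ j, (r (m j))⁻¹) * (M m).det) (fun m hm => by
      obtain ⟨j, j', h, hne⟩ : ∃ j j', m j = m j' ∧ j ≠ j' := by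
        simpa [Function.Injective] using hm
      rw [Matrix.det_zero_of_row_eq (i := (j, 0)) (j := (j', 0)) (by simp [hne]), mul_zero]
      funext a
      simp [M, h])
  rw [h1, h2]
  calc _ = (Fintype.card β).factorial *
        ∑ m : Fin k → Fin k ⊕ β, (∏ j, (r (m j))⁻¹) * (M m).det := by
        field_simp
    _ = _ := by
      rw [← h3]
      refine Finset.sum_congr rfl fun τ _ => ?_
      rw [← Matrix.det_transpose]
      rfl

/-- Integrating out the indices of `β` yields a Pfaffian. -/
lemma signedPairSum_eq_pfaffian {k : ℕ} (q : (Fin k ⊕ β) × Fin 2 → ℂ → ℂ)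
    (r : Fin k ⊕ β → ℂ) (hr : ∀ m, r m ≠ 0) (x : Fin k × Fin 2 → ℂ)
    (B : (Fin k ⊕ β) × Fin 2 → (Fin k ⊕ β) × Fin 2 → ℂ)
    (hB : ∀ a b, B a b = (∑ m, r m * ((if a = (m, 0) then 1 else 0) *
          (if b = (m, 1) then 1 else 0))) - ∑ m, r m * ((if b = (m, 0) then 1 else 0) *
          (if a = (m, 1) then 1 else 0))) :
    signedPairSum (n := Fin k ⊕ β)
      (Sum.elim (fun j a b => q a (x (j, 0)) * q b (x (j, 1))) (fun _ => B)) =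
    2 ^ Fintype.card β * (Fintype.card β).factorial * (∏ m, r m) *
      pfaffian (Matrix.of fun a b => skewKernel q r (x a) (x b)) := by
  have h1 := signedPairSum_antisymm (n := Fin k ⊕ β)
    (Sum.elim (fun j a b => q a (x (j, 0)) * q b (x (j, 1)))
        (fun _ a b => ∑ m, r m * ((if a = (m, 0) then 1 else 0) *
          (if b = (m, 1) then 1 else 0)))) (Finset.univ.map Function.Embedding.inr)
  have h2 : (fun (j : Fin k ⊕ β) a b => if j ∈ Finset.univ.map Function.Embedding.inr then
      (Sum.elim (fun j a b => q a (x (j, 0)) * q b (x (j, 1)))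
        (fun _ a b => ∑ m, r m * ((if a = (m, 0) then 1 else 0) *
          (if b = (m, 1) then 1 else 0)))) j a b - (Sum.elim (fun j a b => q a (x (j, 0)) * q b (x (j, 1)))
        (fun _ a b => ∑ m, r m * ((if a = (m, 0) then 1 else 0) *
          (if b = (m, 1) then 1 else 0)))) j b a else (Sum.elim (fun j a b => q a (x (j, 0)) * q b (x (j, 1)))
        (fun _ a b => ∑ m, r m * ((if a = (m, 0) then 1 else 0) *
          (if b = (m, 1) then 1 else 0)))) j a b) =
      (Sum.elim (fun j a b => q a (x (j, 0)) * q b (x (j, 1))) (fun _ => B)) := by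
    funext j a b
    rcases j with j | j
    · simp
    · rw [if_pos (by simp)]
      simp only [Sum.elim_inr, hB]
  rw [h2, Finset.card_map, Finset.card_univ] at h1
  have h3 := signedPairSum_block (α := Fin k) (β := β) (fun p a => q a (x p)) r
  have h4 := pfaffian_skewKernel q r x
  rw [Fintype.card_fin] at h3
  have hk : (k.factorial : ℂ) ≠ 0 := by exact_mod_cast k.factorial_ne_zero
  -- The norms of the integrated pairs are all the norms divided by those of the `k` remaining
  -- pairs; this produces the inverse norms of the kernel.
  have h5 : ∑ τ : Equiv.Perm (Fin k ⊕ β), (∏ j, r (τ (.inr j))) *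
      (Matrix.of fun (p a : Fin k × Fin 2) => q (τ (.inl a.1), a.2) (x p)).det =
      (∏ m, r m) * ∑ τ : Equiv.Perm (Fin k ⊕ β), (∏ j, (r (τ (.inl j)))⁻¹) *
      (Matrix.of fun (p a : Fin k × Fin 2) => q (τ (.inl a.1), a.2) (x p)).det := by
    rw [Finset.mul_sum]
    refine Finset.sum_congr rfl fun τ _ => ?_
    rw [← mul_assoc]
    congr 1
    rw [← Equiv.prod_comp τ r, Fintype.prod_sum_type, Finset.prod_inv_distrib]
    have : ∏ j, r (τ (.inl j)) ≠ 0 := Finset.prod_ne_zero_iff.2 fun j _ => hr _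
    field_simp
  refine mul_left_cancel₀ hk ?_
  rw [h1, mul_left_comm, h3, h5, ← h4]
  ring

end Algebra

/-! ### Moments of the truncated Gaussian -/

section Moments

/-- The weight `e^{-c|ζ|²}` on the disk of radius `R`. -/
def diskWeight (R c : ℝ) (ζ : ℂ) : ℝ :=
  (Metric.closedBall (0 : ℂ) R).indicator (fun ζ => Real.exp (-(c * ‖ζ‖ ^ 2))) ζ

/-- The moments `∫ |ζ|^{2n} e^{-c|ζ|²} dA` over the disk of radius `R`. -/
def diskMoment (R c : ℝ) (n : ℕ) : ℝ :=
  2 * ∫ r in (0 : ℝ)..R, r ^ (2 * n + 1) * Real.exp (-(c * r ^ 2))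

lemma boltzmann_hardEdgePotential (ρ : ℝ) {N : ℕ} (hN : 0 < N) (ζ : ℂ) :
    boltzmann (hardEdgePotential ρ) N ζ = diskWeight (√2 * ρ) N ζ := by
  unfold boltzmann hardEdgePotential diskWeight
  by_cases h : ‖ζ‖ ≤ √2 * ρ
  · rw [if_pos h, Set.indicator_of_mem (by simpa using h)]
    have : -((N : EReal) * ((‖ζ‖ ^ 2 : ℝ) : EReal)) = ((-(N * ‖ζ‖ ^ 2) : ℝ) : EReal) := by
      push_cast; rfl
    rw [this, EReal.exp_coe, ENNReal.toReal_ofReal (Real.exp_pos _).le]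
  · rw [if_neg h, Set.indicator_of_notMem (by simpa using h),
      EReal.mul_top_of_pos (by exact_mod_cast hN)]
    simp

lemma integrable_mul_diskWeight (R c : ℝ) {f : ℂ → ℂ} (hf : Continuous f) :
    Integrable (fun ζ => f ζ * (diskWeight R c ζ : ℂ)) areaMeasure := by
  have : (fun ζ => f ζ * (diskWeight R c ζ : ℂ)) = (Metric.closedBall (0 : ℂ) R).indicator
      (fun ζ => f ζ * (Real.exp (-(c * ‖ζ‖ ^ 2)) : ℂ)) := by
    funext ζ
    unfold diskWeight
    by_cases h : ζ ∈ Metric.closedBall (0 : ℂ) R <;> simp [h]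
  rw [this]
  refine Integrable.smul_measure_nnreal ?_
  rw [integrable_indicator_iff Metric.isClosed_closedBall.measurableSet]
  exact (by fun_prop : Continuous fun ζ : ℂ => f ζ * (Real.exp (-(c * ‖ζ‖ ^ 2)) : ℂ)).continuousOn.integrableOn_compact (isCompact_closedBall 0 R)

lemma integral_exp_int_mul_I (p q : ℕ) :
    ∫ θ in Set.Ioo (-Real.pi) Real.pi,
      Complex.exp (θ * Complex.I) ^ p * conj (Complex.exp (θ * Complex.I)) ^ q =
      if p = q then 2 * (Real.pi : ℂ) else 0 := by
  rw [← integral_Ioc_eq_integral_Ioo,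
    ← intervalIntegral.integral_of_le (by linarith [Real.pi_pos])]
  have h : ∀ θ : ℝ, Complex.exp (θ * Complex.I) ^ p * conj (Complex.exp (θ * Complex.I)) ^ q =
      Complex.exp ((((p : ℂ) - q) * Complex.I) * θ) := by
    intro θ
    rw [← Complex.exp_conj, ← Complex.exp_nat_mul, ← Complex.exp_nat_mul, ← Complex.exp_add]
    congr 1
    simp
    ring
  simp_rw [h]
  by_cases hpq : p = q
  · subst hpq
    simp
    ring
  · have h0 : ((p : ℂ) - q) * Complex.I ≠ 0 :=
      mul_ne_zero (sub_ne_zero.2 (by exact_mod_cast hpq)) Complex.I_ne_zero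
    rw [if_neg hpq, integral_exp_mul_complex h0, div_eq_zero_iff]
    left
    rw [sub_eq_zero, Complex.exp_eq_exp_iff_exists_int]
    exact ⟨(p : ℤ) - q, by push_cast; ring⟩

lemma integral_pow_mul_conj_pow {R : ℝ} (hR : 0 ≤ R) (c : ℝ) (p q : ℕ) :
    ∫ ζ, ζ ^ p * conj ζ ^ q * (diskWeight R c ζ : ℂ) ∂areaMeasure =
      if p = q then (diskMoment R c p : ℂ) else 0 := by
  have hrad : ∫ r in Set.Ioi (0 : ℝ), (r : ℂ) * ((r : ℂ) ^ p * (r : ℂ) ^ q *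
        ((Set.Iic R).indicator (fun r => Real.exp (-(c * r ^ 2))) r : ℝ)) =
      ((∫ r in (0 : ℝ)..R, r ^ (p + q + 1) * Real.exp (-(c * r ^ 2)) : ℝ) : ℂ) := by
    have h1 : ∀ r : ℝ, (r : ℂ) * ((r : ℂ) ^ p * (r : ℂ) ^ q *
        ((Set.Iic R).indicator (fun r => Real.exp (-(c * r ^ 2))) r : ℝ)) =
        (((Set.Iic R).indicator (fun r => r ^ (p + q + 1) * Real.exp (-(c * r ^ 2))) r : ℝ) : ℂ) := by
      intro r
      by_cases h : r ∈ Set.Iic R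
      · simp [Set.indicator_of_mem h]; ring
      · simp [Set.indicator_of_notMem h]
    simp_rw [h1]
    rw [integral_complex_ofReal, setIntegral_indicator measurableSet_Iic, Set.Ioi_inter_Iic,
      intervalIntegral.integral_of_le hR]
  unfold areaMeasure
  rw [integral_smul_nnreal_measure, ← Complex.integral_comp_polarCoord_symm, polarCoord_target]
  have h2 : ∀ x : ℝ × ℝ, x ∈ Set.Ioi (0 : ℝ) ×ˢ Set.Ioo (-Real.pi) Real.pi →
      x.1 • (Complex.polarCoord.symm x ^ p * conj (Complex.polarCoord.symm x) ^ q *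
      (diskWeight R c (Complex.polarCoord.symm x) : ℂ)) =
      ((x.1 : ℂ) * ((x.1 : ℂ) ^ p * (x.1 : ℂ) ^ q *
        ((Set.Iic R).indicator (fun r => Real.exp (-(c * r ^ 2))) x.1 : ℝ))) *
      (Complex.exp (x.2 * Complex.I) ^ p * conj (Complex.exp (x.2 * Complex.I)) ^ q) := by
    rintro ⟨r, θ⟩ ⟨hr, -⟩
    simp only [Set.mem_Ioi] at hr
    have hw : diskWeight R c (Complex.polarCoord.symm (r, θ)) =
        (Set.Iic R).indicator (fun r => Real.exp (-(c * r ^ 2))) r := by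
      unfold diskWeight
      by_cases h : r ≤ R
      · rw [Set.indicator_of_mem, Set.indicator_of_mem (by simpa using h)]
        · simp
        · simpa [Complex.norm_polarCoord_symm, abs_of_pos hr] using h
      · rw [Set.indicator_of_notMem, Set.indicator_of_notMem (by simpa using h)]
        simpa [Complex.norm_polarCoord_symm, abs_of_pos hr] using h
    rw [hw, Complex.polarCoord_symm_apply]
    simp only [Complex.ofReal_cos, Complex.ofReal_sin, ← Complex.exp_mul_I, map_mul,
      Complex.conj_ofReal, mul_pow, Complex.real_smul]
    ring
  rw [setIntegral_congr_fun (measurableSet_Ioi.prod measurableSet_Ioo) h2]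
  rw [Measure.volume_eq_prod, setIntegral_prod_mul (fun r : ℝ => (r : ℂ) * ((r : ℂ) ^ p * (r : ℂ) ^ q *
        ((Set.Iic R).indicator (fun r => Real.exp (-(c * r ^ 2))) r : ℝ))) (fun θ : ℝ =>
      (Complex.exp (θ * Complex.I) ^ p * conj (Complex.exp (θ * Complex.I)) ^ q)),
    hrad, integral_exp_int_mul_I]
  by_cases hpq : p = q
  · subst hpq
    rw [if_pos rfl, if_pos rfl, diskMoment, ← two_mul]
    have : (Real.pi : ℂ) ≠ 0 := by exact_mod_cast Real.pi_ne_zero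
    rw [NNReal.smul_def, Complex.real_smul]
    push_cast
    rw [NNReal.coe_real_pi]
    field_simp
  · simp [hpq]

lemma continuous_diskMoment_integrand (c : ℝ) (n : ℕ) :
    Continuous fun r : ℝ => r ^ n * Real.exp (-(c * r ^ 2)) := by fun_prop

lemma diskMoment_pos {R : ℝ} (hR : 0 < R) (c : ℝ) (n : ℕ) : 0 < diskMoment R c n := by
  refine mul_pos two_pos (intervalIntegral.intervalIntegral_pos_of_pos_on
    ((continuous_diskMoment_integrand c _).intervalIntegrable _ _) (fun x hx => ?_) hR)
  have := hx.1
  positivity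

/-- Integration by parts. The boundary term at `r = R` is the effect of the hard wall and becomes
the numerator of `edgeRate`. -/
lemma diskMoment_rec (R c : ℝ) (n : ℕ) :
    (n + 1) * diskMoment R c n =
      R ^ (2 * n + 2) * Real.exp (-(c * R ^ 2)) + c * diskMoment R c (n + 1) := by
  have hder : ∀ r ∈ Set.uIcc 0 R, HasDerivAt (fun r : ℝ => r ^ (2 * n + 2) * Real.exp (-(c * r ^ 2)))
      ((2 * n + 2) * (r ^ (2 * n + 1) * Real.exp (-(c * r ^ 2))) -
        2 * c * (r ^ (2 * (n + 1) + 1) * Real.exp (-(c * r ^ 2)))) r := by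
    intro r _
    have h1 := hasDerivAt_pow (2 * n + 2) r
    have h2 : HasDerivAt (fun r : ℝ => Real.exp (-(c * r ^ 2))) _ r :=
      (((hasDerivAt_pow 2 r).const_mul c).neg).exp
    refine (h1.mul h2).congr_deriv ?_
    simp only [Pi.neg_apply, show 2 * n + 2 - 1 = 2 * n + 1 by omega]
    push_cast
    ring
  have hi := fun n => (continuous_diskMoment_integrand c n).intervalIntegrable (μ := volume) 0 R
  have := intervalIntegral.integral_eq_sub_of_hasDerivAt hder
    (((hi _).const_mul _).sub ((hi _).const_mul _))
  rw [intervalIntegral.integral_sub ((hi _).const_mul _) ((hi _).const_mul _),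
    intervalIntegral.integral_const_mul, intervalIntegral.integral_const_mul] at this
  simp only [ne_eq, Nat.add_eq_zero_iff, OfNat.ofNat_ne_zero, and_false, not_false_eq_true, zero_pow,
    zero_mul, sub_zero] at this
  unfold diskMoment
  linarith

lemma diskMoment_succ_le {R : ℝ} (hR : 0 ≤ R) (c : ℝ) (n : ℕ) :
    diskMoment R c (n + 1) ≤ R ^ 2 * diskMoment R c n := by
  have hi := fun n => (continuous_diskMoment_integrand c n).intervalIntegrable (μ := volume) 0 R
  unfold diskMoment
  rw [mul_left_comm (R ^ 2), ← intervalIntegral.integral_const_mul (R ^ 2)]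
  refine mul_le_mul_of_nonneg_left (intervalIntegral.integral_mono_on hR (hi _)
    ((hi _).const_mul _) fun r hr => ?_) two_pos.le
  have h1 : r ^ 2 ≤ R ^ 2 := pow_le_pow_left₀ hr.1 hr.2 2
  have h2 : 0 ≤ r ^ (2 * n + 1) * Real.exp (-(c * r ^ 2)) :=
    mul_nonneg (pow_nonneg hr.1 _) (Real.exp_pos _).le
  calc _ = r ^ 2 * (r ^ (2 * n + 1) * Real.exp (-(c * r ^ 2))) := by ring
    _ ≤ _ := mul_le_mul_of_nonneg_right h1 h2

/-- Log-convexity of the moments. -/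
lemma diskMoment_sq_le {R : ℝ} (hR : 0 < R) (c : ℝ) (n : ℕ) :
    diskMoment R c (n + 1) ^ 2 ≤ diskMoment R c n * diskMoment R c (n + 2) := by
  have hi := fun n => (continuous_diskMoment_integrand c n).intervalIntegrable (μ := volume) 0 R
  -- Cauchy-Schwarz by discriminant: the quadratic in `t` is the integral of `(r² - t)²` against a
  -- nonnegative weight.
  have hq : ∀ t : ℝ, 0 ≤ diskMoment R c n * (t * t) + (-2 * diskMoment R c (n + 1)) * t +
      diskMoment R c (n + 2) := by
    intro t
    have h0 : 0 ≤ ∫ r in (0 : ℝ)..R, (t * t) * (r ^ (2 * n + 1) * Real.exp (-(c * r ^ 2))) -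
        (2 * t) * (r ^ (2 * (n + 1) + 1) * Real.exp (-(c * r ^ 2))) +
        r ^ (2 * (n + 2) + 1) * Real.exp (-(c * r ^ 2)) := by
      refine intervalIntegral.integral_nonneg hR.le fun r hr => ?_
      have : 0 ≤ r ^ (2 * n + 1) * Real.exp (-(c * r ^ 2)) * (r ^ 2 - t) ^ 2 :=
        mul_nonneg (mul_nonneg (pow_nonneg hr.1 _) (Real.exp_pos _).le) (sq_nonneg _)
      refine this.trans_eq ?_
      ring
    rw [intervalIntegral.integral_add (((hi _).const_mul _).sub ((hi _).const_mul _)) (hi _),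
      intervalIntegral.integral_sub ((hi _).const_mul _) ((hi _).const_mul _),
      intervalIntegral.integral_const_mul, intervalIntegral.integral_const_mul] at h0
    unfold diskMoment
    linarith
  have := discrim_le_zero hq
  unfold discrim at this
  linarith

end Moments

/-! ### Skew-orthogonal polynomials of a radial weight -/

section SkewOrthogonal

/-- The skew inner product `∫ P(ζ) Q(ζ̄) (ζ - ζ̄) e^{-c|ζ|²} dA` over the disk of radius `R`. -/
def skewForm (R c : ℝ) (P Q : Polynomial ℂ) : ℂ :=
  ∫ ζ, P.eval ζ * Q.eval (conj ζ) * ((ζ - conj ζ) * (diskWeight R c ζ : ℂ)) ∂areaMeasure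

lemma integrable_skewForm (R c : ℝ) (P Q : Polynomial ℂ) :
    Integrable (fun ζ => P.eval ζ * Q.eval (conj ζ) * ((ζ - conj ζ) * (diskWeight R c ζ : ℂ)))
      areaMeasure := by
  have hc : Continuous fun ζ : ℂ => P.eval ζ * Q.eval (conj ζ) * (ζ - conj ζ) := by
    have := P.continuous
    have := Q.continuous
    have := Complex.continuous_conj
    fun_prop
  simpa only [mul_assoc] using integrable_mul_diskWeight R c hc

lemma skewForm_sum_left (R c : ℝ) {ι : Type*} (s : Finset ι) (a : ι → ℂ)
    (P : ι → Polynomial ℂ) (Q : Polynomial ℂ) :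
    skewForm R c (∑ i ∈ s, Polynomial.C (a i) * P i) Q = ∑ i ∈ s, a i * skewForm R c (P i) Q := by
  unfold skewForm
  simp only [← integral_const_mul]
  rw [← integral_finsetSum _ fun i _ => (integrable_skewForm R c (P i) Q).const_mul _]
  refine integral_congr_ae (Filter.Eventually.of_forall fun ζ => ?_)
  simp only [Polynomial.eval_finsetSum, Polynomial.eval_mul, Polynomial.eval_C, Finset.sum_mul]
  exact Finset.sum_congr rfl fun i _ => by ring

lemma skewForm_sum_right (R c : ℝ) {ι : Type*} (s : Finset ι) (a : ι → ℂ)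
    (P : Polynomial ℂ) (Q : ι → Polynomial ℂ) :
    skewForm R c P (∑ i ∈ s, Polynomial.C (a i) * Q i) = ∑ i ∈ s, a i * skewForm R c P (Q i) := by
  unfold skewForm
  simp only [← integral_const_mul]
  rw [← integral_finsetSum _ fun i _ => (integrable_skewForm R c P (Q i)).const_mul _]
  refine integral_congr_ae (Filter.Eventually.of_forall fun ζ => ?_)
  simp only [Polynomial.eval_finsetSum, Polynomial.eval_mul, Polynomial.eval_C, Finset.sum_mul,
    Finset.mul_sum]
  exact Finset.sum_congr rfl fun i _ => by ring

/-- The factor `ζ - conj ζ` shifts one degree by one, and angular integration keeps only equal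
powers of `ζ` and `conj ζ`. -/
lemma skewForm_X_pow {R : ℝ} (hR : 0 ≤ R) (c : ℝ) (p q : ℕ) :
    skewForm R c (Polynomial.X ^ p) (Polynomial.X ^ q) =
      (if p + 1 = q then (diskMoment R c (p + 1) : ℂ) else 0) -
        if p = q + 1 then (diskMoment R c p : ℂ) else 0 := by
  rw [← integral_pow_mul_conj_pow hR, ← integral_pow_mul_conj_pow hR, skewForm,
    ← integral_sub]
  · refine integral_congr_ae (Filter.Eventually.of_forall fun ζ => ?_)
    simp only [Polynomial.eval_pow, Polynomial.eval_X]
    ring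
  · exact integrable_mul_diskWeight R c (by have := Complex.continuous_conj; fun_prop)
  · exact integrable_mul_diskWeight R c (by have := Complex.continuous_conj; fun_prop)

/-- The coefficients of the skew-orthogonal polynomials of even degree. -/
def skewCoeff (h : ℕ → ℝ) (m l : ℕ) : ℝ :=
  ∏ i ∈ Finset.Ico l m, h (2 * i + 2) / h (2 * i + 1)

/-- The skew-orthogonal polynomials (of degree `2m + i`) of a radially symmetric weight with
moments `h`. -/
def skewPoly (h : ℕ → ℝ) (m : ℕ) (i : Fin 2) : Polynomial ℂ :=
  if i = 0 then ∑ l ∈ Finset.range (m + 1),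
    Polynomial.C ((skewCoeff h m l : ℝ) : ℂ) * Polynomial.X ^ (2 * l)
  else Polynomial.X ^ (2 * m + 1)

lemma skewPoly_zero (h : ℕ → ℝ) (m : ℕ) :
    skewPoly h m 0 = Polynomial.X ^ (2 * m) + ∑ l ∈ Finset.range m,
      Polynomial.C ((skewCoeff h m l : ℝ) : ℂ) * Polynomial.X ^ (2 * l) := by
  rw [skewPoly, if_pos rfl, Finset.sum_range_succ, add_comm]
  simp [skewCoeff]

lemma degree_skewPoly_tail_lt (h : ℕ → ℝ) (m : ℕ) :
    (∑ l ∈ Finset.range m,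
      Polynomial.C ((skewCoeff h m l : ℝ) : ℂ) * Polynomial.X ^ (2 * l)).degree <
      ((2 * m : ℕ) : WithBot ℕ) := by
  refine (Polynomial.degree_sum_le _ _).trans_lt ((Finset.sup_lt_iff (WithBot.bot_lt_coe _)).2
    fun l hl => (Polynomial.degree_C_mul_X_pow_le _ _).trans_lt ?_)
  have := Finset.mem_range.1 hl
  exact_mod_cast (by omega : 2 * l < 2 * m)

lemma skewPoly_monic (h : ℕ → ℝ) (m : ℕ) (i : Fin 2) : (skewPoly h m i).Monic := by
  fin_cases i
  · rw [Fin.zero_eta, skewPoly_zero]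
    exact Polynomial.monic_X_pow_add (degree_skewPoly_tail_lt h m)
  · simp [skewPoly, Polynomial.monic_X_pow]

lemma natDegree_skewPoly (h : ℕ → ℝ) (m : ℕ) (i : Fin 2) :
    (skewPoly h m i).natDegree = i + 2 * m := by
  fin_cases i
  · rw [Fin.zero_eta, skewPoly_zero, Polynomial.natDegree_add_eq_left_of_degree_lt]
    · simp
    · simpa only [Polynomial.degree_X_pow] using degree_skewPoly_tail_lt h m
  · simp [skewPoly, add_comm]

/-- Pairing the even polynomial with `X^{2m+1}` sees only the degrees `2m` and `2m+2`; the
coefficients are chosen so that these two contributions cancel unless the second is absent. -/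
lemma sum_skewCoeff_telescope (h : ℕ → ℝ) (hh : ∀ j, h j ≠ 0) (m n : ℕ) :
    ∑ l ∈ Finset.range (n + 1), (skewCoeff h n l : ℂ) * ((if l = m then (h (2 * m + 1) : ℂ) else 0)
      - if l = m + 1 then (h (2 * m + 2) : ℂ) else 0) = if n = m then (h (2 * m + 1) : ℂ) else 0 := by
  simp only [mul_sub, mul_ite, mul_zero, Finset.sum_sub_distrib, Finset.sum_ite_eq',
    Finset.mem_range]
  rcases lt_trichotomy n m with hnm | rfl | hnm
  · simp [hnm.ne, show ¬ m < n + 1 by omega, show ¬ m < n by omega]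
  · simp [skewCoeff]
  · have h1 : skewCoeff h n m = h (2 * m + 2) / h (2 * m + 1) * skewCoeff h n (m + 1) :=
      Finset.prod_eq_prod_Ico_succ_bot hnm _
    rw [if_pos (by omega), if_pos (by omega), if_neg (by omega), h1]
    have := hh (2 * m + 1)
    have : (h (2 * m + 1) : ℂ) ≠ 0 := by exact_mod_cast this
    push_cast
    field_simp
    ring

lemma skewForm_skewPoly {R : ℝ} (hR : 0 < R) (c : ℝ) (m n : ℕ) (i j : Fin 2) :
    skewForm R c (skewPoly (diskMoment R c) m i) (skewPoly (diskMoment R c) n j) =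
      if m = n then (diskMoment R c (2 * m + 1) : ℂ) * ((if i = 0 ∧ j = 1 then 1 else 0) -
        if i = 1 ∧ j = 0 then 1 else 0) else 0 := by
  have hh : ∀ j, diskMoment R c j ≠ 0 := fun j => (diskMoment_pos hR c j).ne'
  fin_cases i <;> fin_cases j <;>
    simp only [skewPoly, Fin.zero_eta, Fin.mk_one, if_true, one_ne_zero, if_false,
      skewForm_sum_left, skewForm_sum_right, skewForm_X_pow hR.le, zero_ne_one, and_true,
      and_false, sub_zero, mul_one, mul_zero]
  · rw [ite_self]
    refine Finset.sum_eq_zero fun l _ => mul_eq_zero_of_right _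
      (Finset.sum_eq_zero fun l' _ => ?_)
    rw [if_neg (by omega), if_neg (by omega)]
    simp
  · have : (if m = n then (diskMoment R c (2 * m + 1) : ℂ) else 0) =
        if m = n then (diskMoment R c (2 * n + 1) : ℂ) else 0 := by
      by_cases h : m = n <;> simp [h]
    rw [this, ← sum_skewCoeff_telescope (diskMoment R c) hh n m]
    refine Finset.sum_congr rfl fun l _ => ?_
    congr 2
    · by_cases h : l = n
      · subst h; simp
      · rw [if_neg h, if_neg (by omega)]
    · by_cases h : l = n + 1
      · subst h; simp [mul_add]
      · rw [if_neg h, if_neg (by omega)]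
  · have : (if m = n then (diskMoment R c (2 * m + 1) : ℂ) * (0 - 1) else 0) =
      -if n = m then (diskMoment R c (2 * m + 1) : ℂ) else 0 := by
      by_cases h : m = n <;> simp [h, eq_comm]
    rw [this, ← sum_skewCoeff_telescope (diskMoment R c) hh m n, ← Finset.sum_neg_distrib]
    refine Finset.sum_congr rfl fun l _ => ?_
    rw [← mul_neg, neg_sub]
    congr 2
    · by_cases h : l = m + 1
      · subst h; simp [mul_add]
      · rw [if_neg h, if_neg (by omega)]
    · by_cases h : l = m
      · subst h; simp
      · rw [if_neg h, if_neg (by omega)]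
  · rw [ite_self, if_neg (by omega), if_neg (by omega), sub_zero]

end SkewOrthogonal

/-! ### The joint weight as a determinant -/

section JointWeight

/-- Lexicographic order on the pairs splits the Vandermonde product into interactions between
different pairs and one factor inside each pair. For conjugate pairs the latter is `conj ζ_j - ζ_j`,
one of the two factors of `|ζ_j - conj ζ_j|²`; the other stays in the skew form. -/
lemma prod_vandermonde_pairs {N : ℕ} (x : Fin N × Fin 2 → ℂ) :
    ∏ a : Fin (N * 2), ∏ b ∈ Finset.Ioi a,
      (x (finProdFinEquiv.symm b) - x (finProdFinEquiv.symm a)) =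
    (∏ j, ∏ k ∈ Finset.Iio j, ((x (j, 0) - x (k, 0)) * (x (j, 1) - x (k, 0)) *
      ((x (j, 0) - x (k, 1)) * (x (j, 1) - x (k, 1))))) * ∏ j, (x (j, 1) - x (j, 0)) := by
  have hlt : ∀ (a b : Fin N × Fin 2), finProdFinEquiv a < finProdFinEquiv b ↔
      (a.1 < b.1 ∨ a.1 = b.1 ∧ a.2 < b.2) := by
    rintro ⟨a, i⟩ ⟨b, j⟩
    simp only [Fin.lt_def, finProdFinEquiv_apply_val, Fin.ext_iff]
    have := i.2
    have := j.2
    omega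
  have h1 : ∏ a : Fin (N * 2), ∏ b ∈ Finset.Ioi a,
      (x (finProdFinEquiv.symm b) - x (finProdFinEquiv.symm a)) =
      ∏ a : Fin N × Fin 2, ∏ b : Fin N × Fin 2,
        if a.1 < b.1 ∨ a.1 = b.1 ∧ a.2 < b.2 then x b - x a else 1 := by
    rw [← Equiv.prod_comp finProdFinEquiv]
    refine Finset.prod_congr rfl fun a _ => ?_
    rw [← Finset.prod_filter, ← Finset.filter_lt_eq_Ioi, Finset.prod_filter, Finset.prod_filter,
      ← Equiv.prod_comp finProdFinEquiv]
    simp only [hlt, Equiv.symm_apply_apply]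
  have h2 : ∀ j k : Fin N, (∏ i : Fin 2, ∏ i' : Fin 2,
      if j < k ∨ j = k ∧ i < i' then x (k, i') - x (j, i) else 1) =
      (if j < k then (x (k, 0) - x (j, 0)) * (x (k, 1) - x (j, 0)) *
        ((x (k, 0) - x (j, 1)) * (x (k, 1) - x (j, 1))) else 1) *
      if j = k then x (j, 1) - x (j, 0) else 1 := by
    intro j k
    rcases lt_trichotomy j k with h | rfl | h
    · simp [Fin.prod_univ_two, h, h.ne]
    · simp [Fin.prod_univ_two]
    · simp [h.not_gt, h.ne']
  have h3 : ∏ a : Fin N × Fin 2, ∏ b : Fin N × Fin 2,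
        (if a.1 < b.1 ∨ a.1 = b.1 ∧ a.2 < b.2 then x b - x a else 1) =
      ∏ j : Fin N, ∏ k : Fin N, ∏ i : Fin 2, ∏ i' : Fin 2,
        if j < k ∨ j = k ∧ i < i' then x (k, i') - x (j, i) else 1 := by
    simp only [Fintype.prod_prod_type]
    exact Finset.prod_congr rfl fun j _ => Finset.prod_comm
  rw [h1, h3]
  simp only [h2, Finset.prod_mul_distrib (f := fun k => if _ < k then _ else _),
    Finset.prod_ite_eq, Finset.mem_univ, if_true]
  rw [Finset.prod_mul_distrib]
  congr 1
  rw [Finset.prod_comm]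
  refine Finset.prod_congr rfl fun j _ => ?_
  rw [← Finset.prod_filter, Finset.filter_gt_eq_Iio]

/-- The points `ζ_j` (at `(j, 0)`) together with their conjugates (at `(j, 1)`). -/
def conjPair {n : Type*} (ζ : n → ℂ) (a : n × Fin 2) : ℂ := ![ζ a.1, conj (ζ a.1)] a.2

/-- The joint weight is, up to one-particle factors, a determinant of polynomials. -/
lemma jointWeight_eq_det (Q : ℂ → EReal) (N : ℕ) (h : ℕ → ℝ) (ζ : Fin N → ℂ) :
    (jointWeight Q N ζ : ℂ) =
      (Matrix.of fun a b : Fin N × Fin 2 => (skewPoly h b.1 b.2).eval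
        (conjPair ζ a)).det *
      ∏ j, (ζ j - conj (ζ j)) * (boltzmann Q N (ζ j) : ℂ) := by
  have hsq : ∀ w : ℂ, ((‖w‖ ^ 2 : ℝ) : ℂ) = w * conj w := fun w => by
    rw [Complex.mul_conj, Complex.normSq_eq_norm_sq]
  have hdet : (Matrix.of fun a b : Fin N × Fin 2 => (skewPoly h b.1 b.2).eval
        (conjPair ζ a)).det =
      ∏ a : Fin (N * 2), ∏ b ∈ Finset.Ioi a,
      (conjPair ζ (finProdFinEquiv.symm b) -
        conjPair ζ (finProdFinEquiv.symm a)) := by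
    rw [← Matrix.det_vandermonde, ← Matrix.det_submatrix_equiv_self finProdFinEquiv.symm,
      Matrix.det_eval_matrixOfPolynomials_eq_det_vandermonde
        (fun a => conjPair ζ (finProdFinEquiv.symm a))
        (fun a => skewPoly h (finProdFinEquiv.symm a).1 (finProdFinEquiv.symm a).2)]
    · rfl
    · intro a
      rw [natDegree_skewPoly, ← finProdFinEquiv_apply_val, Equiv.apply_symm_apply]
    · exact fun a => skewPoly_monic _ _ _
  rw [hdet, prod_vandermonde_pairs]
  simp only [jointWeight, conjPair, Matrix.cons_val_zero, Matrix.cons_val_one]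
  push_cast
  simp only [← Complex.ofReal_pow, hsq, map_sub, Complex.conj_conj]
  rw [mul_assoc]
  congr 1
  · exact Finset.prod_congr rfl fun j _ => Finset.prod_congr rfl fun k _ => by ring
  · rw [← Finset.prod_mul_distrib (s := Finset.univ) (f := fun j => conj (ζ j) - ζ j)]
    exact Finset.prod_congr rfl fun j _ => by ring

end JointWeight

/-! ### Correlation functions as Pfaffians at finite `N` -/

section Correlation

instance : SigmaFinite areaMeasure := by unfold areaMeasure; infer_instance

/-- By Fubini every permutation term factorises: an integrated point couples only to the two columns
assigned to `ζ_j` and `conj ζ_j`. -/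
lemma integral_det_skewPoly {k : ℕ} {β : Type*} [Fintype β] [DecidableEq β]
    (R c : ℝ) (P : (Fin k ⊕ β) × Fin 2 → Polynomial ℂ) (ζ : Fin k → ℂ) :
    ∫ η : β → ℂ, (Matrix.of fun a b : (Fin k ⊕ β) × Fin 2 =>
        (P b).eval (conjPair (Sum.elim ζ η) a)).det *
      ∏ j, (Sum.elim ζ η j - conj (Sum.elim ζ η j)) * (diskWeight R c (Sum.elim ζ η j) : ℂ)
      ∂(Measure.pi fun _ => areaMeasure) =
    (∏ j, (ζ j - conj (ζ j)) * (diskWeight R c (ζ j) : ℂ)) *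
      signedPairSum (n := Fin k ⊕ β) (Sum.elim
        (fun j a b => (P a).eval (conjPair ζ (j, 0)) * (P b).eval (conjPair ζ (j, 1)))
        (fun _ a b => skewForm R c (P a) (P b))) := by
  have h1 : ∀ η : β → ℂ, (Matrix.of fun a b : (Fin k ⊕ β) × Fin 2 =>
        (P b).eval (conjPair (Sum.elim ζ η) a)).det *
      ∏ j, (Sum.elim ζ η j - conj (Sum.elim ζ η j)) * (diskWeight R c (Sum.elim ζ η j) : ℂ) =
      ∑ σ : Equiv.Perm ((Fin k ⊕ β) × Fin 2), (∏ j, (ζ j - conj (ζ j)) * (diskWeight R c (ζ j) : ℂ)) *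
        (((Equiv.Perm.sign σ : ℤ) : ℂ) * ∏ j : Fin k, (P (σ (.inl j, 0))).eval (conjPair ζ (j, 0)) *
          (P (σ (.inl j, 1))).eval (conjPair ζ (j, 1))) *
        ∏ j : β, (P (σ (.inr j, 0))).eval (η j) * (P (σ (.inr j, 1))).eval (conj (η j)) *
          ((η j - conj (η j)) * (diskWeight R c (η j) : ℂ)) := by
    intro η
    rw [← signedPairSum_eq_det (fun a b => (P b).eval (conjPair (Sum.elim ζ η) a)), signedPairSum,
      Finset.sum_mul]
    refine Finset.sum_congr rfl fun σ _ => ?_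
    rw [Fintype.prod_sum_type, Fintype.prod_sum_type,
      Finset.prod_mul_distrib (f := fun j => (P (σ (.inr j, 0))).eval (η j) *
        (P (σ (.inr j, 1))).eval (conj (η j)))]
    simp only [conjPair, Sum.elim_inl, Sum.elim_inr, Matrix.cons_val_zero, Matrix.cons_val_one]
    ring
  simp_rw [h1]
  rw [integral_finsetSum, signedPairSum, Finset.mul_sum]
  · refine Finset.sum_congr rfl fun σ _ => ?_
    rw [integral_const_mul, integral_fintype_prod_eq_prod (fun j z =>
      (P (σ (.inr j, 0))).eval z * (P (σ (.inr j, 1))).eval (conj z) *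
          ((z - conj z) * (diskWeight R c z : ℂ))), Fintype.prod_sum_type]
    simp only [Sum.elim_inl, Sum.elim_inr, skewForm, mul_assoc]
  · intro σ _
    exact (Integrable.fintype_prod (f := fun j z =>
      (P (σ (.inr j, 0))).eval z * (P (σ (.inr j, 1))).eval (conj z) *
          ((z - conj z) * (diskWeight R c z : ℂ)))
      fun j => integrable_skewForm R c _ _).const_mul _

/-- The finite-size kernel of the ensemble on a disk. -/
def diskKernel (R c : ℝ) (N : ℕ) (x y : ℂ) : ℂ :=
  skewKernel (n := Fin N) (fun a z => (skewPoly (diskMoment R c) a.1 a.2).eval z)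
    (fun m => (diskMoment R c (2 * m + 1) : ℂ)) x y

lemma integral_jointWeight {ρ : ℝ} (hρ : 0 < ρ) {N k : ℕ} (hN : 0 < N) (hk : k ≤ N)
    (ζ : Fin k → ℂ) :
    ∫ η : Fin (N - k) → ℂ, (jointWeight (hardEdgePotential ρ) N (extendConfig ζ η) : ℂ)
      ∂(Measure.pi fun _ => areaMeasure) =
    (∏ j, (ζ j - conj (ζ j)) * (diskWeight (√2 * ρ) N (ζ j) : ℂ)) *
      (2 ^ (N - k) * (N - k).factorial *
        (∏ m : Fin N, (diskMoment (√2 * ρ) N (2 * m + 1) : ℂ)) *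
        pfaffian (Matrix.of fun a b =>
          diskKernel (√2 * ρ) N N (conjPair ζ a) (conjPair ζ b))) := by
  set R := √2 * ρ with hR
  have hR0 : 0 < R := by positivity
  set h := diskMoment R N with hh
  let e : Fin k ⊕ Fin (N - k) ≃ Fin N :=
    finSumFinEquiv.trans (finCongr (by omega))
  have he : ∀ (η : Fin (N - k) → ℂ) j, extendConfig ζ η (e j) = Sum.elim ζ η j := by
    intro η j
    rcases j with j | j
    · simp [e, extendConfig]
    · simp [e, extendConfig]
  have h1 : ∀ η : Fin (N - k) → ℂ,
      (jointWeight (hardEdgePotential ρ) N (extendConfig ζ η) : ℂ) =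
      (Matrix.of fun a b : (Fin k ⊕ Fin (N - k)) × Fin 2 =>
        (skewPoly h (e b.1) b.2).eval (conjPair (Sum.elim ζ η) a)).det *
      ∏ j, (Sum.elim ζ η j - conj (Sum.elim ζ η j)) *
        (diskWeight R N (Sum.elim ζ η j) : ℂ) := by
    intro η
    rw [jointWeight_eq_det _ _ h, ← Equiv.prod_comp e,
      ← Matrix.det_submatrix_equiv_self (e.prodCongr (Equiv.refl (Fin 2)))]
    simp only [he, boltzmann_hardEdgePotential ρ hN]
    congr 2
    ext a b
    simp [conjPair, he]
  simp_rw [h1]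
  rw [integral_det_skewPoly R N (fun b => skewPoly h (e b.1) b.2)]
  congr 1
  have := signedPairSum_eq_pfaffian (β := Fin (N - k))
    (fun (b : (Fin k ⊕ Fin (N - k)) × Fin 2) z => (skewPoly h (e b.1) b.2).eval z)
    (fun m => (h (2 * (e m) + 1) : ℂ))
    (fun m => by exact_mod_cast (diskMoment_pos hR0 N _).ne') (conjPair ζ)
    (fun a b => skewForm R N (skewPoly h (e a.1) a.2) (skewPoly h (e b.1) b.2)) ?_
  · rw [this, Fintype.card_fin, Equiv.prod_comp e fun m => (h (2 * m + 1) : ℂ)]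
    congr 2
    ext a b
    simp only [Matrix.of_apply, diskKernel, skewKernel]
    rw [← Equiv.sum_comp e]
  · rintro ⟨m, i⟩ ⟨n, j⟩
    have hmn : ((e m : ℕ) = e n) ↔ m = n := by rw [← Fin.ext_iff, e.apply_eq_iff_eq]
    rw [hh, skewForm_skewPoly hR0]
    have h01 : (0 : Fin 2) ≠ 1 := by decide
    by_cases hm : m = n
    · subst hm
      rw [if_pos rfl, mul_sub]
      congr 1
      · rw [Finset.sum_eq_single m (fun x _ hx => by simp [Ne.symm hx]) (by simp)]
        by_cases hi : i = 0 <;> by_cases hj : j = 1 <;> simp [hi, hj]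
      · rw [Finset.sum_eq_single m (fun x _ hx => by simp [Ne.symm hx]) (by simp)]
        by_cases hi : i = 1 <;> by_cases hj : j = 0 <;> simp [hi, hj]
    · rw [if_neg (by rwa [hmn]), Finset.sum_eq_zero, Finset.sum_eq_zero, sub_zero]
      · intro x _
        by_cases hx : n = x
        · subst hx; simp [hm]
        · simp [hx]
      · intro x _
        by_cases hx : m = x
        · subst hx; simp [Ne.symm hm]
        · simp [hx]

lemma correlation_eq_pfaffian {ρ : ℝ} (hρ : 0 < ρ) {N k : ℕ} (hN : 0 < N) (hk : k ≤ N)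
    (ζ : Fin k → ℂ) :
    (correlation (hardEdgePotential ρ) N k ζ : ℂ) =
    (∏ j, (ζ j - conj (ζ j)) * (diskWeight (√2 * ρ) N (ζ j) : ℂ)) *
      ((1 / 2) ^ k * pfaffian (Matrix.of fun a b =>
          diskKernel (√2 * ρ) N N (conjPair ζ a) (conjPair ζ b))) := by
  -- The case `k = 0` evaluates `Z_N`. In the quotient the norms and factorials cancel and `2^{N-k}
  -- / 2^N` gives `(1/2)^k`.
  have hZ := integral_jointWeight hρ hN (Nat.zero_le N) (fun _ : Fin 0 => 0)
  have hpf : ∀ A : Matrix (Fin 0 × Fin 2) (Fin 0 × Fin 2) ℂ, pfaffian A = 1 := by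
    intro A; simp [pfaffian]
  have hext : ∀ η : Fin (N - 0) → ℂ, extendConfig (fun _ : Fin 0 => 0) η = η := fun η => rfl
  simp only [hext, hpf, Finset.univ_eq_empty, Finset.prod_empty, one_mul, mul_one,
    Nat.sub_zero] at hZ
  have hZ' : (partitionFunction (hardEdgePotential ρ) N : ℂ) = _ :=
    (integral_complex_ofReal).symm.trans hZ
  unfold correlation
  have hR0 : 0 < √2 * ρ := by positivity
  have hprod : (∏ m : Fin N, (diskMoment (√2 * ρ) N (2 * m + 1) : ℂ)) ≠ 0 :=
    Finset.prod_ne_zero_iff.2 fun m _ => by exact_mod_cast (diskMoment_pos hR0 N _).ne'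
  have hfac : ((N - k).factorial : ℂ) * N.descFactorial k = N.factorial := by
    exact_mod_cast Nat.factorial_mul_descFactorial hk
  have hN0 : (N.factorial : ℂ) ≠ 0 := by exact_mod_cast N.factorial_ne_zero
  have h2 : (2 : ℂ) ^ N = 2 ^ (N - k) * 2 ^ k := by rw [← pow_add, Nat.sub_add_cancel hk]
  simp only [jointDensity, integral_div]
  push_cast
  rw [← integral_complex_ofReal, integral_jointWeight hρ hN hk, hZ', ← hfac, h2]
  have hf1 : ((N - k).factorial : ℂ) ≠ 0 := by exact_mod_cast (N - k).factorial_ne_zero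
  have hf2 : (N.descFactorial k : ℂ) ≠ 0 := by
    intro h; rw [h, mul_zero] at hfac; exact hN0 hfac.symm
  rw [div_pow, one_pow]
  field_simp

end Correlation

/-! ### Asymptotics of the moments from recursion and log-concavity -/

section EdgeSequence
open Filter Topology

/-- The inverse normalised moments of `e^{-c|ζ|²}` on the disk of radius `R`. -/
def edgeRate (R c : ℝ) (j : ℕ) : ℝ :=
  R ^ (2 * j + 2) * Real.exp (-(c * R ^ 2)) / diskMoment R c j

/-- The properties of `edgeRate` from which its asymptotics follow. -/
structure IsEdgeSeq (C : ℝ) (b : ℕ → ℝ) : Prop where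
  pos : ∀ j, 0 < b j
  recur : ∀ j : ℕ, b (j + 1) * (j + 1 - b j) = C * b j
  mono : ∀ j, b j ≤ b (j + 1)
  le : ∀ j : ℕ, b j ≤ j + 1
  logConcave : ∀ j, b j * b (j + 2) ≤ b (j + 1) ^ 2

lemma isEdgeSeq_edgeRate {R c : ℝ} (hR : 0 < R) (hc : 0 ≤ c) :
    IsEdgeSeq (c * R ^ 2) (edgeRate R c) := by
  have hp := diskMoment_pos hR c
  have hE : 0 < Real.exp (-(c * R ^ 2)) := Real.exp_pos _
  refine ⟨fun j => by have := hp j; unfold edgeRate; positivity, fun j => ?_, fun j => ?_,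
    fun j => ?_, fun j => ?_⟩
  · have h1 := diskMoment_rec R c j
    have h2 := (hp j).ne'
    have h3 := (hp (j + 1)).ne'
    have h4 : c * diskMoment R c (j + 1) =
      (j + 1) * diskMoment R c j - R ^ (2 * j + 2) * Real.exp (-(c * R ^ 2)) := by linarith
    unfold edgeRate
    rw [div_mul_eq_mul_div, div_eq_iff h3]
    calc _ = R ^ (2 * (j + 1) + 2) * Real.exp (-(c * R ^ 2)) *
          ((j + 1) * diskMoment R c j - R ^ (2 * j + 2) * Real.exp (-(c * R ^ 2))) /
          diskMoment R c j := by field_simp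
      _ = _ := by rw [← h4]; field_simp; ring
  · unfold edgeRate
    rw [div_le_div_iff₀ (hp _) (hp _)]
    have h1 := diskMoment_succ_le hR.le c j
    calc _ ≤ R ^ (2 * j + 2) * Real.exp (-(c * R ^ 2)) * (R ^ 2 * diskMoment R c j) := by gcongr
      _ = _ := by ring
  · unfold edgeRate
    rw [div_le_iff₀ (hp _), diskMoment_rec]
    have := (hp (j + 1)).le
    have := mul_nonneg hc this
    linarith
  · unfold edgeRate
    have h1 := diskMoment_sq_le hR c j
    rw [div_mul_div_comm, div_pow, div_le_div_iff₀ (mul_pos (hp _) (hp _)) (pow_pos (hp _) 2)]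
    calc _ ≤ R ^ (2 * j + 2) * Real.exp (-(c * R ^ 2)) *
          (R ^ (2 * (j + 2) + 2) * Real.exp (-(c * R ^ 2))) *
          (diskMoment R c j * diskMoment R c (j + 2)) := by gcongr
      _ = _ := by ring

namespace IsEdgeSeq

variable {C : ℝ} {b : ℕ → ℝ}

lemma sub_le (h : IsEdgeSeq C b) (j : ℕ) : j + 1 - C ≤ b j := by
  have h1 := h.recur j
  have h2 : b j * (j + 1 - b j) ≤ b (j + 1) * (j + 1 - b j) :=
    mul_le_mul_of_nonneg_right (h.mono j) (by linarith [h.le j])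
  have h3 : b j * (j + 1 - b j) ≤ b j * C := by linarith
  linarith [le_of_mul_le_mul_left h3 (h.pos j)]

/-- By the recursion `j + 1 - b j = C * (b j / b (j + 1))`, and log-concavity makes this ratio
nondecreasing in `j`. -/
lemma succ_le (h : IsEdgeSeq C b) (hC : 0 ≤ C) (j : ℕ) : b (j + 1) ≤ b j + 1 := by
  have h0 := h.pos j
  have h1 := h.pos (j + 1)
  have h2 := h.pos (j + 2)
  have e1 : j + 1 - b j = C * (b j / b (j + 1)) := by
    have := h.recur j
    field_simp
    linarith
  have e2 : (j + 1 : ℝ) + 1 - b (j + 1) = C * (b (j + 1) / b (j + 2)) := by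
    have := h.recur (j + 1)
    push_cast at this
    field_simp
    linarith
  have e3 : b j / b (j + 1) ≤ b (j + 1) / b (j + 2) := by
    rw [div_le_div_iff₀ h1 h2]
    linarith [h.logConcave j]
  have := mul_le_mul_of_nonneg_left e3 hC
  linarith

/-- Inserting `succ_le` into the recursion closes it to a quadratic inequality in `b j` alone, whose
root yields the upper bound matching `sub_le`. -/
lemma sq_le (h : IsEdgeSeq C b) (hC : 0 ≤ C) (j : ℕ) : b j ^ 2 ≤ b j * (j - C) + (j + 1) := by
  have h1 := h.recur j
  have h2 := mul_le_mul_of_nonneg_right (h.succ_le hC j)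
    (by linarith [h.le j] : (0 : ℝ) ≤ j + 1 - b j)
  nlinarith

lemma le_max_add_sqrt (h : IsEdgeSeq C b) (hC : 0 ≤ C) (j : ℕ) :
    b j ≤ max (j - C) 0 + √(j + 1) := by
  have h1 := h.sq_le hC j
  have h2 := h.pos j
  have h3 : (0 : ℝ) ≤ j + 1 := by positivity
  by_contra! hlt
  have h4 := Real.sq_sqrt h3
  have h5 : 0 < √((j : ℝ) + 1) := Real.sqrt_pos.2 (by positivity)
  have h6 : b j * (j - C) ≤ b j * max (j - C) 0 :=
    mul_le_mul_of_nonneg_left (le_max_left _ _) h2.le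
  have h7 : √((j : ℝ) + 1) < b j := by linarith [le_max_right ((j : ℝ) - C) 0]
  have h8 : √((j : ℝ) + 1) < b j - max (j - C) 0 := by linarith
  nlinarith

end IsEdgeSeq

/-- The coefficients of the finite-size kernel. -/
def edgeCoeff (b : ℕ → ℝ) (m l : ℕ) : ℝ :=
  b (2 * m + 1) * ∏ i ∈ Finset.Ico l m, b (2 * i + 1) / b (2 * i + 2)

lemma edgeCoeff_pos {C : ℝ} {b : ℕ → ℝ} (h : IsEdgeSeq C b) (m l : ℕ) : 0 < edgeCoeff b m l :=
  mul_pos (h.pos _) (Finset.prod_pos fun _ _ => div_pos (h.pos _) (h.pos _))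

lemma edgeCoeff_le {C : ℝ} {b : ℕ → ℝ} (h : IsEdgeSeq C b) (m l : ℕ) :
    edgeCoeff b m l ≤ 2 * m + 2 := by
  have h1 : ∏ i ∈ Finset.Ico l m, b (2 * i + 1) / b (2 * i + 2) ≤ 1 :=
    Finset.prod_le_one (fun _ _ => (div_pos (h.pos _) (h.pos _)).le)
      fun i _ => (div_le_one (h.pos _)).2 (h.mono _)
  have h2 := h.le (2 * m + 1)
  push_cast at h2
  calc _ ≤ b (2 * m + 1) * 1 := mul_le_mul_of_nonneg_left h1 (h.pos _).le
    _ ≤ _ := by linarith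

/-- Log-concavity places `(b (2i+1) / b (2i+2))²` between `b (2i) / b (2i+2)` and `b (2i+1) / b
(2i+3)`, and both products telescope. The two bounds agree to leading order. -/
lemma edgeCoeff_sq_bounds {C : ℝ} {b : ℕ → ℝ} (h : IsEdgeSeq C b) {m l : ℕ} (hlm : l ≤ m) :
    b (2 * m + 1) * b (2 * l) ≤ edgeCoeff b m l ^ 2 ∧
      edgeCoeff b m l ^ 2 ≤ b (2 * m + 1) * b (2 * l + 1) := by
  have key : b (2 * l) ≤ b (2 * m) * (∏ i ∈ Finset.Ico l m, b (2 * i + 1) / b (2 * i + 2)) ^ 2 ∧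
      (∏ i ∈ Finset.Ico l m, b (2 * i + 1) / b (2 * i + 2)) ^ 2 * b (2 * m + 1) ≤
        b (2 * l + 1) := by
    induction m, hlm using Nat.le_induction with
    | base => simp
    | succ m hm ih =>
      rw [Finset.prod_Ico_succ_top hm]
      set P := ∏ i ∈ Finset.Ico l m, b (2 * i + 1) / b (2 * i + 2)
      have p1 := h.pos (2 * m + 1)
      have p2 := h.pos (2 * m + 2)
      rw [show 2 * (m + 1) = 2 * m + 2 by ring]
      constructor
      · refine ih.1.trans ?_
        have : b (2 * m) ≤ b (2 * m + 1) ^ 2 / b (2 * m + 2) := by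
          rw [le_div_iff₀ p2]; exact h.logConcave _
        calc _ ≤ b (2 * m + 1) ^ 2 / b (2 * m + 2) * P ^ 2 := by gcongr
          _ = _ := by field_simp
      · refine le_trans ?_ ih.2
        have : b (2 * m + 1) * b (2 * m + 3) / b (2 * m + 2) ^ 2 ≤ 1 := by
          rw [div_le_one (by positivity)]; exact h.logConcave _
        calc _ = P ^ 2 * b (2 * m + 1) * (b (2 * m + 1) * b (2 * m + 3) / b (2 * m + 2) ^ 2) := by
              rw [show 2 * m + 2 + 1 = 2 * m + 3 by ring]; field_simp
          _ ≤ P ^ 2 * b (2 * m + 1) * 1 := by gcongr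
          _ = _ := mul_one _
  unfold edgeCoeff
  set P := ∏ i ∈ Finset.Ico l m, b (2 * i + 1) / b (2 * i + 2)
  have p1 := (h.pos (2 * m + 1)).le
  have p2 := h.mono (2 * m)
  constructor
  · calc _ ≤ b (2 * m + 1) * (b (2 * m) * P ^ 2) := by gcongr; exact key.1
      _ ≤ b (2 * m + 1) * (b (2 * m + 1) * P ^ 2) := by gcongr
      _ = _ := by ring
  · calc _ = b (2 * m + 1) * (P ^ 2 * b (2 * m + 1)) := by ring
      _ ≤ _ := by gcongr; exact key.2

variable {ι : Type*} {F : Filter ι} {N : ι → ℕ}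

/-- Squeeze between `sub_le` with positivity and `le_max_add_sqrt`; the square root is of order
`√N`, hence negligible. -/
lemma tendsto_edgeSeq (hN : Tendsto N F atTop) {a τ : ℝ} (ha : 0 ≤ a)
    {b : ι → ℕ → ℝ} (hb : ∀ i, IsEdgeSeq (N i * a) (b i)) {j : ι → ℕ}
    (hj : Tendsto (fun i => (j i : ℝ) / N i) F (𝓝 τ)) :
    Tendsto (fun i => b i (j i) / N i) F (𝓝 (max (τ - a) 0)) := by
  have hN' : Tendsto (fun i => (N i : ℝ)) F atTop := tendsto_natCast_atTop_atTop.comp hN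
  have hinv : Tendsto (fun i => (N i : ℝ)⁻¹) F (𝓝 0) := tendsto_inv_atTop_zero.comp hN'
  have hpos : ∀ᶠ i in F, (0 : ℝ) < N i := hN'.eventually_gt_atTop 0
  have hmax : Tendsto (fun i => max ((j i : ℝ) / N i - a) 0) F (𝓝 (max (τ - a) 0)) :=
    (hj.sub_const a).max tendsto_const_nhds
  have hsq : Tendsto (fun i => √(((j i : ℝ) / N i + (N i : ℝ)⁻¹) * (N i : ℝ)⁻¹)) F (𝓝 0) := by
    have := ((hj.add hinv).mul hinv).sqrt
    simpa using this
  have hup := hmax.add hsq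
  rw [add_zero] at hup
  refine tendsto_of_tendsto_of_tendsto_of_le_of_le' hmax hup ?_ ?_
  · filter_upwards [hpos] with i hi
    rw [le_div_iff₀ hi, max_mul_of_nonneg _ _ hi.le, zero_mul, sub_mul, div_mul_cancel₀ _ hi.ne']
    refine max_le ?_ ((hb i).pos _).le
    linarith [(hb i).sub_le (j i)]
  · filter_upwards [hpos] with i hi
    have h1 := (hb i).le_max_add_sqrt (by positivity) (j i)
    rw [div_le_iff₀ hi, add_mul, max_mul_of_nonneg _ _ hi.le, zero_mul, sub_mul,
      div_mul_cancel₀ _ hi.ne']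
    have h2 : √(((j i : ℝ) / N i + (N i : ℝ)⁻¹) * (N i : ℝ)⁻¹) * N i = √(j i + 1) := by
      rw [← Real.sqrt_mul_self hi.le, ← Real.sqrt_mul (by positivity), Real.sqrt_mul_self hi.le]
      congr 1
      field_simp
    rw [h2, mul_comm a]
    exact h1

lemma tendsto_edgeCoeff (hN : Tendsto N F atTop) {a s t : ℝ} (ha : 0 ≤ a)
    {b : ι → ℕ → ℝ} (hb : ∀ i, IsEdgeSeq (N i * a) (b i)) {m l : ι → ℕ}
    (hlm : ∀ᶠ i in F, l i ≤ m i)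
    (hm : Tendsto (fun i => (m i : ℝ) / N i) F (𝓝 s))
    (hl : Tendsto (fun i => (l i : ℝ) / N i) F (𝓝 t)) :
    Tendsto (fun i => edgeCoeff (b i) (m i) (l i) / N i) F
      (𝓝 (√(2 * s - a) * √(2 * t - a))) := by
  have hN' : Tendsto (fun i => (N i : ℝ)) F atTop := tendsto_natCast_atTop_atTop.comp hN
  have hinv : Tendsto (fun i => (N i : ℝ)⁻¹) F (𝓝 0) := tendsto_inv_atTop_zero.comp hN'
  have hodd : ∀ {k : ι → ℕ} {r : ℝ}, Tendsto (fun i => (k i : ℝ) / N i) F (𝓝 r) →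
      Tendsto (fun i => ((2 * k i + 1 : ℕ) : ℝ) / N i) F (𝓝 (2 * r)) := by
    intro k r hk
    have := (hk.const_mul 2).add hinv
    rw [add_zero] at this
    refine this.congr fun i => ?_
    push_cast
    ring
  have heven : Tendsto (fun i => ((2 * l i : ℕ) : ℝ) / N i) F (𝓝 (2 * t)) := by
    refine (hl.const_mul 2).congr fun i => ?_
    push_cast
    ring
  have h1 := tendsto_edgeSeq hN ha hb (hodd hm)
  have h2 := tendsto_edgeSeq hN ha hb (hodd hl)
  have h3 := tendsto_edgeSeq hN ha hb heven
  have hsq : Tendsto (fun i => (edgeCoeff (b i) (m i) (l i) / N i) ^ 2) F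
      (𝓝 (max (2 * s - a) 0 * max (2 * t - a) 0)) := by
    refine tendsto_of_tendsto_of_tendsto_of_le_of_le' (h1.mul h3) (h1.mul h2) ?_ ?_
    · filter_upwards [hlm] with i hi
      rw [div_mul_div_comm, div_pow, ← sq]
      exact div_le_div_of_nonneg_right (edgeCoeff_sq_bounds (hb i) hi).1 (by positivity)
    · filter_upwards [hlm] with i hi
      rw [div_mul_div_comm, div_pow, ← sq]
      exact div_le_div_of_nonneg_right (edgeCoeff_sq_bounds (hb i) hi).2 (by positivity)
  have h4 := hsq.sqrt
  rw [Real.sqrt_mul (le_max_right _ _)] at h4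
  have h5 : ∀ x : ℝ, √(max x 0) = √x := fun x => by
    rcases le_total x 0 with h | h
    · rw [max_eq_right h, Real.sqrt_zero, Real.sqrt_eq_zero_of_nonpos h]
    · rw [max_eq_left h]
  rw [h5, h5] at h4
  refine h4.congr fun i => Real.sqrt_sq ?_
  exact div_nonneg (edgeCoeff_pos (hb i) _ _).le (Nat.cast_nonneg _)

end EdgeSequence

/-! ### The double sum as a Riemann sum -/

section Limit
open Filter Topology

variable {ι : Type*} {F : Filter ι} {N : ι → ℕ}

lemma tendsto_one_add_pow {x : ι → ℂ} {n : ι → ℕ} {t : ℂ} (hx : Tendsto x F (𝓝 0))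
    (hn : Tendsto (fun i => (n i : ℂ) * x i) F (𝓝 t)) :
    Tendsto (fun i => (1 + x i) ^ n i) F (𝓝 (Complex.exp t)) := by
  have h1 : Tendsto (fun i => (n i : ℂ) * (Complex.log (1 + x i) - x i)) F (𝓝 0) := by
    refine Asymptotics.IsBigO.trans_tendsto (g'' := fun i => (n i : ℂ) * x i * x i) ?_ ?_
    · have := (Asymptotics.isBigO_refl (fun i => (n i : ℂ)) F).mul
        (Complex.log_sub_self_isBigO.comp_tendsto hx)
      refine this.congr (fun _ => rfl) fun i => ?_
      simp only [Function.comp_apply]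
      ring
    · simpa using hn.mul hx
  have h2 : Tendsto (fun i => (n i : ℂ) * Complex.log (1 + x i)) F (𝓝 t) := by
    have := h1.add hn
    rw [zero_add] at this
    exact this.congr fun i => by ring
  refine ((Complex.continuous_exp.tendsto t).comp h2).congr' ?_
  have h3 : ∀ᶠ i in F, 1 + x i ≠ 0 :=
    (by simpa using hx.const_add 1 : Tendsto (fun i => 1 + x i) F (𝓝 1)).eventually_ne one_ne_zero
  filter_upwards [h3] with i hi
  rw [Function.comp_apply, Complex.exp_nat_mul, Complex.exp_log hi]

lemma tendsto_floor_mul_div (hN : Tendsto N F atTop) {s : ℝ} (hs : 0 ≤ s) :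
    Tendsto (fun i => ((⌊(N i : ℝ) * s⌋₊ : ℕ) : ℝ) / N i) F (𝓝 s) := by
  have := (tendsto_nat_floor_mul_div_atTop hs).comp (tendsto_natCast_atTop_atTop.comp hN)
  simpa [Function.comp_def, mul_comm] using this

lemma measurable_floor_comp (f : ℕ → ℂ) (n : ℕ) : Measurable fun s : ℝ => f ⌊(n : ℝ) * s⌋₊ :=
  (measurable_from_nat (f := f)).comp (Nat.measurable_floor.comp (measurable_const_mul _))

lemma mean_eq_integral_floor (f : ℕ → ℂ) {n : ℕ} (hn : 0 < n) :
    (1 / (n : ℂ)) * ∑ m ∈ Finset.range n, f m = ∫ s in (0 : ℝ)..1, f ⌊(n : ℝ) * s⌋₊ := by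
  have hn' : (0 : ℝ) < n := by exact_mod_cast hn
  have hle : ∀ k : ℕ, (k : ℝ) / n ≤ ((k + 1 : ℕ) : ℝ) / n := fun k => by
    gcongr; simp
  have hfl : ∀ k : ℕ, ∀ s ∈ Set.Ioo ((k : ℝ) / n) (((k + 1 : ℕ) : ℝ) / n),
      f ⌊(n : ℝ) * s⌋₊ = f k := by
    intro k s hs
    have h1 := (div_lt_iff₀ hn').1 hs.1
    have h2 := (lt_div_iff₀ hn').1 hs.2
    congr 1
    rw [Nat.floor_eq_iff (by nlinarith [(Nat.cast_nonneg k : (0 : ℝ) ≤ k)])]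
    push_cast at h2
    constructor <;> linarith
  have hint : ∀ k : ℕ, ∫ s in ((k : ℝ) / n)..(((k + 1 : ℕ) : ℝ) / n), f ⌊(n : ℝ) * s⌋₊ =
      (1 / (n : ℂ)) * f k := by
    intro k
    rw [intervalIntegral.integral_of_le (hle k), integral_Ioc_eq_integral_Ioo,
      setIntegral_congr_fun measurableSet_Ioo (hfl k), ← integral_Ioc_eq_integral_Ioo,
      ← intervalIntegral.integral_of_le (hle k), intervalIntegral.integral_const,
      Complex.real_smul]
    push_cast
    ring
  have hii : ∀ k < n, IntervalIntegrable (fun s : ℝ => f ⌊(n : ℝ) * s⌋₊) volume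
      ((k : ℝ) / n) (((k + 1 : ℕ) : ℝ) / n) := by
    intro k _
    rw [intervalIntegrable_iff_integrableOn_Ioo_of_le (hle k)]
    exact (integrableOn_const (C := f k) (by simp)).congr_fun (fun s hs => (hfl k s hs).symm)
      measurableSet_Ioo
  have := intervalIntegral.sum_integral_adjacent_intervals hii
  simp only [hint, ← Finset.mul_sum] at this
  rw [this]
  simp [hn'.ne']

/-- Riemann sums with varying summands, by dominated convergence. -/
lemma tendsto_mean_range [F.IsCountablyGenerated] (hN : Tendsto N F atTop) (f : ι → ℕ → ℂ)
    (g : ℝ → ℂ) (K : ℝ) (hK : ∀ᶠ i in F, ∀ m < N i, ‖f i m‖ ≤ K)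
    (hlim : ∀ᵐ s : ℝ, s ∈ Set.Ioo (0 : ℝ) 1 →
      Tendsto (fun i => f i ⌊(N i : ℝ) * s⌋₊) F (𝓝 (g s))) :
    Tendsto (fun i => (1 / (N i : ℂ)) * ∑ m ∈ Finset.range (N i), f i m) F
      (𝓝 (∫ s in (0 : ℝ)..1, g s)) := by
  have hpos : ∀ᶠ i in F, 0 < N i := hN.eventually_gt_atTop 0
  have hne : ∀ᵐ s : ℝ, s ≠ 1 := by simp [ae_iff]
  have h1 : Tendsto (fun i => ∫ s in (0 : ℝ)..1, f i ⌊(N i : ℝ) * s⌋₊) F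
      (𝓝 (∫ s in (0 : ℝ)..1, g s)) := by
    refine intervalIntegral.tendsto_integral_filter_of_dominated_convergence (fun _ => K)
      (Eventually.of_forall fun i => (measurable_floor_comp _ _).aestronglyMeasurable) ?_
      intervalIntegrable_const ?_
    · filter_upwards [hK, hpos] with i hi hi0
      filter_upwards [hne] with s hs1 hs
      rw [Set.uIoc_of_le zero_le_one] at hs
      refine hi _ ?_
      have hs2 : s < 1 := lt_of_le_of_ne hs.2 hs1
      have hi0' : (0 : ℝ) < N i := by exact_mod_cast hi0
      rw [Nat.floor_lt (by have := hs.1; positivity)]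
      nlinarith
    · filter_upwards [hne, hlim] with s hs1 hs2 hs
      rw [Set.uIoc_of_le zero_le_one] at hs
      exact hs2 ⟨hs.1, lt_of_le_of_ne hs.2 hs1⟩
  refine h1.congr' ?_
  filter_upwards [hpos] with i hi
  exact (mean_eq_integral_floor _ hi).symm

/-- The double sum in the finite-size kernel. -/
def edgeSum (N : ℕ) (b : ℕ → ℝ) (X Y : ℂ) : ℂ :=
  ∑ m ∈ Finset.range N, ∑ l ∈ Finset.range N,
    if l ≤ m then (edgeCoeff b m l : ℂ) * (X ^ (2 * m + 1) * Y ^ (2 * l)) else 0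

/-- Of the three factors `1 / N`, two are the mesh of the double Riemann sum and one normalises
`edgeCoeff`. The hypotheses `‖1 + x‖ ≤ 1` and `‖1 + y‖ ≤ 1` bound all powers and supply the
domination. -/
lemma tendsto_edgeSum [F.IsCountablyGenerated] (hN : Tendsto N F atTop) {a : ℝ} (ha : 0 ≤ a)
    {b : ι → ℕ → ℝ} (hb : ∀ i, IsEdgeSeq (N i * a) (b i)) {x y : ι → ℂ} {ξ η : ℂ}
    (hx : Tendsto (fun i => (N i : ℂ) * x i) F (𝓝 ξ))
    (hy : Tendsto (fun i => (N i : ℂ) * y i) F (𝓝 η))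
    (hx1 : ∀ᶠ i in F, ‖1 + x i‖ ≤ 1) (hy1 : ∀ᶠ i in F, ‖1 + y i‖ ≤ 1) :
    Tendsto (fun i => (1 / (N i : ℂ)) ^ 3 * edgeSum (N i) (b i) (1 + x i) (1 + y i)) F
      (𝓝 (∫ s in (0 : ℝ)..1, ∫ t in (0 : ℝ)..1, if t < s then
        (√(2 * s - a) * √(2 * t - a) : ℝ) * (Complex.exp (2 * s * ξ) * Complex.exp (2 * t * η))
        else 0)) := by
  have hN' : Tendsto (fun i => (N i : ℝ)) F atTop := tendsto_natCast_atTop_atTop.comp hN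
  have hinv : Tendsto (fun i => ((N i : ℂ))⁻¹) F (𝓝 0) := by
    have := (Complex.continuous_ofReal.tendsto 0).comp (tendsto_inv_atTop_zero.comp hN')
    simpa [Function.comp_def] using this
  have hpos : ∀ᶠ i in F, 0 < N i := hN.eventually_gt_atTop 0
  have hzero : ∀ {x : ι → ℂ} {ξ : ℂ}, Tendsto (fun i => (N i : ℂ) * x i) F (𝓝 ξ) →
      Tendsto x F (𝓝 0) := by
    intro x ξ hx
    have := hx.mul hinv
    rw [mul_zero] at this
    refine this.congr' ?_
    filter_upwards [hpos] with i hi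
    have : (N i : ℂ) ≠ 0 := by exact_mod_cast hi.ne'
    field_simp
  have hpow : ∀ {x : ι → ℂ} {ξ : ℂ} {r : ℝ} {n : ι → ℕ} (d : ℕ),
      Tendsto (fun i => (N i : ℂ) * x i) F (𝓝 ξ) →
      Tendsto (fun i => (n i : ℝ) / N i) F (𝓝 r) →
      Tendsto (fun i => (1 + x i) ^ (2 * n i + d)) F (𝓝 (Complex.exp (2 * r * ξ))) := by
    intro x ξ r n d hx hn
    refine tendsto_one_add_pow (hzero hx) ?_
    have h1 : Tendsto (fun i => ((n i : ℝ) / N i : ℝ) * 2 + (d : ℂ) * (N i : ℂ)⁻¹) F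
        (𝓝 ((r : ℂ) * 2 + d * 0)) :=
      (((Complex.continuous_ofReal.tendsto r).comp hn).mul_const 2).add (hinv.const_mul _)
    have h2 := h1.mul hx
    rw [mul_zero, add_zero, mul_comm (r : ℂ)] at h2
    refine h2.congr' ?_
    filter_upwards [hpos] with i hi
    have : (N i : ℂ) ≠ 0 := by exact_mod_cast hi.ne'
    push_cast
    field_simp
  let H (i : ι) (m l : ℕ) : ℂ := if l ≤ m then ((edgeCoeff (b i) m l / N i : ℝ) : ℂ) *
    ((1 + x i) ^ (2 * m + 1) * (1 + y i) ^ (2 * l)) else 0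
  have hH : ∀ᶠ i in F, ∀ m < N i, ∀ l < N i, ‖H i m l‖ ≤ 2 := by
    filter_upwards [hx1, hy1, hpos] with i hxi hyi hi m hm l _
    have hi' : (0 : ℝ) < N i := by exact_mod_cast hi
    simp only [H]
    split_ifs
    · rw [norm_mul, norm_mul, norm_pow, norm_pow, Complex.norm_real, Real.norm_eq_abs,
        abs_of_pos (div_pos (edgeCoeff_pos (hb i) m l) hi')]
      have h1 : edgeCoeff (b i) m l / N i ≤ 2 := by
        rw [div_le_iff₀ hi']
        have h2 : (m : ℝ) + 1 ≤ N i := by exact_mod_cast hm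
        linarith [edgeCoeff_le (hb i) m l]
      have h3 : ‖1 + x i‖ ^ (2 * m + 1) * ‖1 + y i‖ ^ (2 * l) ≤ 1 :=
        mul_le_one₀ (pow_le_one₀ (norm_nonneg _) hxi) (by positivity)
          (pow_le_one₀ (norm_nonneg _) hyi)
      calc _ ≤ 2 * (1 : ℝ) := by gcongr
        _ = 2 := mul_one 2
    · simp
  have hinner : ∀ s ∈ Set.Ioo (0 : ℝ) 1, Tendsto (fun i => (1 / (N i : ℂ)) *
      ∑ l ∈ Finset.range (N i), H i ⌊(N i : ℝ) * s⌋₊ l) F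
      (𝓝 (∫ t in (0 : ℝ)..1, if t < s then
        (√(2 * s - a) * √(2 * t - a) : ℝ) * (Complex.exp (2 * s * ξ) * Complex.exp (2 * t * η))
        else 0)) := by
    intro s hs
    have hms := tendsto_floor_mul_div hN hs.1.le
    refine tendsto_mean_range hN _ _ 2 ?_ ?_
    · filter_upwards [hH, hpos] with i hi hi0 l hl
      refine hi _ ?_ l hl
      have hi0' : (0 : ℝ) < N i := by exact_mod_cast hi0
      rw [Nat.floor_lt (by have := hs.1; positivity)]
      nlinarith [hs.2]
    -- On the diagonal `t = s` the comparison of the floors need not settle in the limit, but it is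
    -- a null set.
    · have hne : ∀ᵐ t : ℝ, t ≠ s := by simp [ae_iff]
      filter_upwards [hne] with t hts ht
      have hlt := tendsto_floor_mul_div hN ht.1.le
      rcases lt_or_gt_of_ne hts with hlt' | hgt
      · have hle : ∀ i, ⌊(N i : ℝ) * t⌋₊ ≤ ⌊(N i : ℝ) * s⌋₊ := fun i =>
          Nat.floor_mono (mul_le_mul_of_nonneg_left hlt'.le (Nat.cast_nonneg _))
        simp only [H, if_pos hlt', if_pos (hle _)]
        refine ((Complex.continuous_ofReal.tendsto _).comp (tendsto_edgeCoeff hN ha hb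
          (Eventually.of_forall hle) hms hlt)).mul ((hpow 1 hx hms).mul ?_)
        simpa using hpow 0 hy hlt
      · rw [if_neg hgt.not_gt]
        refine tendsto_const_nhds.congr' ?_
        filter_upwards [hms.eventually_lt hlt hgt, hpos] with i hi hi0
        have hi0' : (0 : ℝ) < N i := by exact_mod_cast hi0
        have : ⌊(N i : ℝ) * s⌋₊ < ⌊(N i : ℝ) * t⌋₊ := by
          exact_mod_cast (div_lt_div_iff_of_pos_right hi0').1 hi
        simp only [H, if_neg this.not_ge]
  have houter := tendsto_mean_range hN
    (fun i m => (1 / (N i : ℂ)) * ∑ l ∈ Finset.range (N i), H i m l) _ 2 ?_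
    (Eventually.of_forall hinner)
  · refine houter.congr fun i => ?_
    simp only [edgeSum, Finset.mul_sum]
    refine Finset.sum_congr rfl fun m _ => Finset.sum_congr rfl fun l _ => ?_
    simp only [H]
    split_ifs
    · push_cast; ring
    · simp
  · filter_upwards [hH, hpos] with i hi hi0 m hm
    have hi0' : (0 : ℝ) < N i := by exact_mod_cast hi0
    rw [norm_mul]
    have h1 : ‖∑ l ∈ Finset.range (N i), H i m l‖ ≤ N i * 2 := by
      refine (norm_sum_le_of_le _ fun l hl => hi m hm l (Finset.mem_range.1 hl)).trans ?_
      simp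
    calc _ ≤ ‖1 / (N i : ℂ)‖ * (N i * 2) := by gcongr
      _ = 2 := by
        rw [norm_div, norm_one, Complex.norm_natCast]
        field_simp

end Limit

/-! ### The limiting kernel -/

section HardEdgeKernel
open Filter Topology

lemma continuous_hardEdge_integrand :
    Continuous fun p : ℂ × ℝ => (√p.2 : ℂ) * Complex.exp (2 * p.1 * p.2) := by
  fun_prop

lemma continuous_hardEdgeFun : Continuous fun p : ℂ × ℝ => hardEdgeFun p.1 p.2 := by
  have h : Continuous (Function.uncurry fun (p : ℂ × ℝ) (t : ℝ) =>
      (√t : ℂ) * Complex.exp (2 * p.1 * t)) :=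
    continuous_hardEdge_integrand.comp
      ((continuous_fst.comp continuous_fst).prodMk continuous_snd)
  exact intervalIntegral.continuous_parametric_intervalIntegral_of_continuous h continuous_snd

lemma deriv_hardEdgeFun (z : ℂ) (u : ℝ) :
    deriv (hardEdgeFun z) u = (√u : ℂ) * Complex.exp (2 * z * u) :=
  Continuous.deriv_integral _
    (continuous_hardEdge_integrand.comp (by fun_prop : Continuous fun t : ℝ => (z, t))) 0 u

/-- Rests on the convention `√t = 0` for `t ≤ 0`, which discards the degrees below the threshold
`2ρ²N` without splitting integrals. -/
lemma hardEdgeFun_of_nonpos (z : ℂ) {u : ℝ} (hu : u ≤ 0) : hardEdgeFun z u = 0 := by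
  unfold hardEdgeFun
  rw [intervalIntegral.integral_congr (g := fun _ => 0), intervalIntegral.integral_zero]
  intro t ht
  rw [Set.uIcc_of_ge hu] at ht
  simp [Real.sqrt_eq_zero_of_nonpos ht.2]

/-- Half of the hard edge kernel before antisymmetrisation. -/
def edgeLimit (z w : ℂ) : ℂ :=
  ∫ u in (0 : ℝ)..1, ((√u : ℂ) * Complex.exp (2 * z * u)) * hardEdgeFun w u

lemma continuous_edgeLimit_integrand : Continuous (Function.uncurry fun (p : ℂ × ℂ) (u : ℝ) =>
    ((√u : ℂ) * Complex.exp (2 * p.1 * u)) * hardEdgeFun p.2 u) :=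
  (continuous_hardEdge_integrand.comp
      ((continuous_fst.comp continuous_fst).prodMk continuous_snd)).mul
    (continuous_hardEdgeFun.comp ((continuous_snd.comp continuous_fst).prodMk continuous_snd))

lemma continuous_edgeLimit : Continuous fun p : ℂ × ℂ => edgeLimit p.1 p.2 :=
  intervalIntegral.continuous_parametric_intervalIntegral_of_continuous'
    continuous_edgeLimit_integrand 0 1

lemma hardEdgeKernel_eq (z w : ℂ) : hardEdgeKernel z w = edgeLimit z w - edgeLimit w z := by
  have hi : ∀ z w : ℂ, IntervalIntegrable (fun u : ℝ =>
      ((√u : ℂ) * Complex.exp (2 * z * u)) * hardEdgeFun w u) volume 0 1 := fun z w =>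
    (continuous_edgeLimit_integrand.comp
      (by fun_prop : Continuous fun u : ℝ => ((z, w), u))).intervalIntegrable _ _
  unfold hardEdgeKernel edgeLimit
  rw [← intervalIntegral.integral_sub (hi z w) (hi w z),
    intervalIntegral.integral_of_le zero_le_one, integral_Ioc_eq_integral_Ioo]
  refine integral_congr_ae (Eventually.of_forall fun u => ?_)
  simp only [wronskian, deriv_hardEdgeFun]
  ring

lemma continuous_hardEdgeKernel : Continuous fun p : ℂ × ℂ => hardEdgeKernel p.1 p.2 := by
  simp only [hardEdgeKernel_eq]
  have h : Continuous ((fun p : ℂ × ℂ => edgeLimit p.1 p.2) ∘ fun p : ℂ × ℂ => (p.2, p.1)) :=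
    continuous_edgeLimit.comp (continuous_snd.prodMk continuous_fst)
  exact continuous_edgeLimit.sub h

/-- Substitute `u = (s - ρ²) / (1 - ρ²)` in both variables. Each substitution gives a factor `1 -
ρ²`, and the square roots give `2 (1 - ρ²)`. -/
lemma integral_edge_eq {ρ : ℝ} (hρ : ρ ∈ Set.Ioo (0 : ℝ) 1) (z w : ℂ) :
    (∫ s in (0 : ℝ)..1, ∫ t in (0 : ℝ)..1, if t < s then
        (√(2 * s - 2 * ρ ^ 2) * √(2 * t - 2 * ρ ^ 2) : ℝ) *
          (Complex.exp (2 * s * (z / (1 - ρ ^ 2))) * Complex.exp (2 * t * (w / (1 - ρ ^ 2))))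
        else 0) =
      2 * (1 - ρ ^ 2) ^ 3 * (Complex.exp (2 * ρ ^ 2 / (1 - ρ ^ 2) * z) *
        Complex.exp (2 * ρ ^ 2 / (1 - ρ ^ 2) * w)) * edgeLimit z w := by
  obtain ⟨h0, h1⟩ := hρ
  set κ : ℝ := 1 - ρ ^ 2 with hκ
  have hκ0 : 0 < κ := by rw [hκ]; nlinarith
  have hκc : (κ : ℂ) ≠ 0 := by exact_mod_cast hκ0.ne'
  have hκ' : (1 - (ρ : ℂ) ^ 2) = (κ : ℂ) := by rw [hκ]; push_cast; ring
  rw [hκ']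
  let g (z : ℂ) (u : ℝ) : ℂ := (√u : ℂ) * Complex.exp (2 * z * u)
  have hsplit : ∀ s t : ℝ, ((√(2 * s - 2 * ρ ^ 2) * √(2 * t - 2 * ρ ^ 2) : ℝ) : ℂ) *
          (Complex.exp (2 * s * (z / κ)) * Complex.exp (2 * t * (w / κ))) =
      2 * κ * (Complex.exp (2 * ρ ^ 2 / κ * z) * Complex.exp (2 * ρ ^ 2 / κ * w)) *
        (g z (s / κ - ρ ^ 2 / κ) * g w (t / κ - ρ ^ 2 / κ)) := by
    intro s t
    have hs : ∀ s : ℝ, √(2 * s - 2 * ρ ^ 2) = √(2 * κ) * √(s / κ - ρ ^ 2 / κ) := by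
      intro s
      rw [← Real.sqrt_mul (by positivity)]
      congr 1
      field_simp
    have he : ∀ (s : ℝ) (z : ℂ), Complex.exp (2 * s * (z / κ)) =
        Complex.exp (2 * ρ ^ 2 / κ * z) * Complex.exp (2 * z * ((s / κ - ρ ^ 2 / κ : ℝ) : ℂ)) := by
      intro s z
      rw [← Complex.exp_add]
      congr 1
      push_cast
      field_simp
      ring
    have h2 : ((√(2 * κ) : ℝ) : ℂ) * ((√(2 * κ) : ℝ) : ℂ) = 2 * κ := by
      rw [← Complex.ofReal_mul, Real.mul_self_sqrt (by positivity)]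
      push_cast; ring
    rw [hs s, hs t, he s, he t, ← h2]
    simp only [g]
    push_cast
    ring
  have hg : ∀ z, Continuous (g z) := fun z =>
    continuous_hardEdge_integrand.comp (by fun_prop : Continuous fun t : ℝ => (z, t))
  have hinner : ∀ s ∈ Set.Ioo (0 : ℝ) 1, (∫ t in (0 : ℝ)..1, if t < s then
        ((√(2 * s - 2 * ρ ^ 2) * √(2 * t - 2 * ρ ^ 2) : ℝ) : ℂ) *
          (Complex.exp (2 * s * (z / κ)) * Complex.exp (2 * t * (w / κ))) else 0) =
      2 * κ * (Complex.exp (2 * ρ ^ 2 / κ * z) * Complex.exp (2 * ρ ^ 2 / κ * w)) *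
        (g z (s / κ - ρ ^ 2 / κ) * (κ * hardEdgeFun w (s / κ - ρ ^ 2 / κ))) := by
    intro s hs
    have hcut : ∀ f : ℝ → ℂ, (∫ t in (0 : ℝ)..1, if t < s then f t else 0) =
        ∫ t in (0 : ℝ)..s, f t := by
      intro f
      rw [intervalIntegral.integral_of_le zero_le_one, intervalIntegral.integral_of_le hs.1.le,
        integral_Ioc_eq_integral_Ioo (x := (0 : ℝ)) (y := s)]
      have : (fun t => if t < s then f t else 0) = (Set.Iio s).indicator f := by
        funext t; simp [Set.indicator_apply]
      rw [this, setIntegral_indicator measurableSet_Iio]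
      congr 2
      ext t
      simp only [Set.mem_inter_iff, Set.mem_Ioc, Set.mem_Iio, Set.mem_Ioo]
      constructor
      · rintro ⟨⟨h1, -⟩, h2⟩; exact ⟨h1, h2⟩
      · rintro ⟨h1, h2⟩; exact ⟨⟨h1, by linarith [hs.2]⟩, h2⟩
    rw [hcut]
    simp only [hsplit]
    rw [intervalIntegral.integral_const_mul, intervalIntegral.integral_const_mul,
      intervalIntegral.integral_comp_div_sub (g w) hκ0.ne', Complex.real_smul]
    congr 3
    have hadd := intervalIntegral.integral_add_adjacent_intervals
      ((hg w).intervalIntegrable (μ := volume) 0 (0 / κ - ρ ^ 2 / κ))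
      ((hg w).intervalIntegrable (0 / κ - ρ ^ 2 / κ) (s / κ - ρ ^ 2 / κ))
    have hz : ∫ t in (0 : ℝ)..(0 / κ - ρ ^ 2 / κ), g w t = 0 :=
      hardEdgeFun_of_nonpos w (by
        have : 0 ≤ ρ ^ 2 / κ := by positivity
        rw [zero_div]; linarith)
    rw [hz, zero_add] at hadd
    exact hadd
  have hne : ∀ᵐ s : ℝ, s ≠ 1 := by simp [ae_iff]
  have houter := intervalIntegral.integral_congr_ae (μ := volume) (a := (0 : ℝ)) (b := 1)
    (f := fun s => ∫ t in (0 : ℝ)..1, if t < s then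
        ((√(2 * s - 2 * ρ ^ 2) * √(2 * t - 2 * ρ ^ 2) : ℝ) : ℂ) *
          (Complex.exp (2 * s * (z / κ)) * Complex.exp (2 * t * (w / κ))) else 0)
    (g := fun s => 2 * κ * (Complex.exp (2 * ρ ^ 2 / κ * z) * Complex.exp (2 * ρ ^ 2 / κ * w)) *
        (g z (s / κ - ρ ^ 2 / κ) * (κ * hardEdgeFun w (s / κ - ρ ^ 2 / κ)))) (by
      filter_upwards [hne] with s hs1 hs
      rw [Set.uIoc_of_le zero_le_one] at hs
      exact hinner s ⟨hs.1, lt_of_le_of_ne hs.2 hs1⟩)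
  have hG : Continuous fun u : ℝ => g z u * hardEdgeFun w u :=
    continuous_edgeLimit_integrand.comp (by fun_prop : Continuous fun u : ℝ => ((z, w), u))
  have hfinal : ∫ u in (0 / κ - ρ ^ 2 / κ)..(1 / κ - ρ ^ 2 / κ), g z u * hardEdgeFun w u =
      edgeLimit z w := by
    have h1 : 1 / κ - ρ ^ 2 / κ = 1 := by rw [← sub_div, ← hκ, div_self hκ0.ne']
    have hadd := intervalIntegral.integral_add_adjacent_intervals
      (hG.intervalIntegrable (μ := volume) (0 / κ - ρ ^ 2 / κ) 0) (hG.intervalIntegrable 0 1)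
    have hz : ∫ u in (0 / κ - ρ ^ 2 / κ)..0, g z u * hardEdgeFun w u = 0 := by
      rw [intervalIntegral.integral_congr (g := fun _ => 0), intervalIntegral.integral_zero]
      intro u hu
      have : 0 ≤ ρ ^ 2 / κ := by positivity
      rw [Set.uIcc_of_le (by rw [zero_div]; linarith)] at hu
      simp [hardEdgeFun_of_nonpos w hu.2]
    rw [hz, zero_add] at hadd
    rw [h1, ← hadd]
    rfl
  rw [houter, intervalIntegral.integral_const_mul]
  have hcomm : ∀ s : ℝ, g z (s / κ - ρ ^ 2 / κ) * (κ * hardEdgeFun w (s / κ - ρ ^ 2 / κ)) =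
      κ * (g z (s / κ - ρ ^ 2 / κ) * hardEdgeFun w (s / κ - ρ ^ 2 / κ)) := fun s => by ring
  simp only [hcomm]
  rw [intervalIntegral.integral_const_mul, intervalIntegral.integral_comp_div_sub
    (fun u => g z u * hardEdgeFun w u) hκ0.ne', hfinal, Complex.real_smul]
  ring

end HardEdgeKernel

/-! ### Exact rescaling of the finite kernel -/

section Scaling

lemma pfaffian_scale {n : ℕ} (A : Matrix (Fin n × Fin 2) (Fin n × Fin 2) ℂ)
    (d : Fin n × Fin 2 → ℂ) (e : ℂ) :
    pfaffian (Matrix.of fun a b => e * (d a * d b) * A a b) =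
      e ^ n * (∏ j, d (j, 0) * d (j, 1)) * pfaffian A := by
  unfold pfaffian
  rw [mul_left_comm]
  congr 1
  rw [Finset.mul_sum]
  refine Finset.sum_congr rfl fun σ _ => ?_
  simp only [Matrix.of_apply, Finset.prod_mul_distrib, Finset.prod_const, Finset.card_univ,
    Fintype.card_fin]
  have h : (∏ j, d (σ (j, 0))) * ∏ j, d (σ (j, 1)) = (∏ j, d (j, 0)) * ∏ j, d (j, 1) := by
    have := Equiv.prod_comp σ d
    rw [Fintype.prod_prod_type, Fintype.prod_prod_type] at this
    simpa only [Fin.prod_univ_two, Finset.prod_mul_distrib] using this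
  rw [h]
  ring

/-- Extracting the powers of `R` turns moment ratios into ratios of `edgeRate`. Every term has odd
total degree, so exactly one sign `s` survives. -/
lemma diskKernel_scaled {R : ℝ} (hR : 0 < R) (c : ℝ) (N : ℕ) {s : ℂ}
    (hs : s * s = 1) (X Y : ℂ) :
    diskKernel R c N (s * (R * X)) (s * (R * Y)) =
      Real.exp (c * R ^ 2) * ((R : ℂ) ^ 3)⁻¹ * s *
        (edgeSum N (edgeRate R c) Y X - edgeSum N (edgeRate R c) X Y) := by
  have hR' : (R : ℂ) ≠ 0 := by exact_mod_cast hR.ne'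
  have hp := diskMoment_pos hR c
  have hcoef : ∀ {m l : ℕ}, l ≤ m → (diskMoment R c (2 * m + 1))⁻¹ * skewCoeff (diskMoment R c) m l =
      Real.exp (c * R ^ 2) * (R ^ (2 * m + 2 * l + 4))⁻¹ * edgeCoeff (edgeRate R c) m l := by
    intro m l hlm
    have h1 : ∀ i, diskMoment R c (2 * i + 2) / diskMoment R c (2 * i + 1) =
        R ^ 2 * (edgeRate R c (2 * i + 1) / edgeRate R c (2 * i + 2)) := by
      intro i
      have e1 := (hp (2 * i + 1)).ne'
      have e2 := (hp (2 * i + 2)).ne'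
      unfold edgeRate
      field_simp
      ring
    have h2 : (diskMoment R c (2 * m + 1))⁻¹ =
        Real.exp (c * R ^ 2) * (R ^ (4 * m + 4))⁻¹ * edgeRate R c (2 * m + 1) := by
      have e1 := (hp (2 * m + 1)).ne'
      unfold edgeRate
      rw [Real.exp_neg]
      have := (Real.exp_pos (c * R ^ 2)).ne'
      field_simp
      ring
    obtain ⟨d, rfl⟩ := Nat.exists_eq_add_of_le hlm
    unfold skewCoeff edgeCoeff
    simp only [h1, Finset.prod_mul_distrib, Finset.prod_const, Nat.card_Ico]
    rw [h2, Nat.add_sub_cancel_left]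
    field_simp
    ring
  have hpow : ∀ (k : ℕ), s ^ (2 * k) = 1 := fun k => by rw [pow_mul, sq, hs, one_pow]
  have hhalf : ∀ X Y : ℂ, ∑ m : Fin N, ((diskMoment R c (2 * m + 1) : ℂ))⁻¹ *
      ((skewPoly (diskMoment R c) m 0).eval (s * (R * X)) *
        (skewPoly (diskMoment R c) m 1).eval (s * (R * Y))) =
      Real.exp (c * R ^ 2) * ((R : ℂ) ^ 3)⁻¹ * s * edgeSum N (edgeRate R c) Y X := by
    intro X Y
    rw [Fin.sum_univ_eq_sum_range (fun m => ((diskMoment R c (2 * m + 1) : ℂ))⁻¹ *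
      ((skewPoly (diskMoment R c) m 0).eval (s * (R * X)) *
        (skewPoly (diskMoment R c) m 1).eval (s * (R * Y)))) N, edgeSum, Finset.mul_sum]
    refine Finset.sum_congr rfl fun m hm => ?_
    have hsub : Finset.range (m + 1) ⊆ Finset.range N := by
      intro l hl
      have := Finset.mem_range.1 hl
      have := Finset.mem_range.1 hm
      exact Finset.mem_range.2 (by omega)
    rw [← Finset.sum_subset hsub (fun l _ hl => by
      rw [Finset.mem_range] at hl
      exact if_neg (by omega))]
    simp only [skewPoly, if_true, one_ne_zero, if_false, Polynomial.eval_finsetSum,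
      Polynomial.eval_mul, Polynomial.eval_C, Polynomial.eval_pow, Polynomial.eval_X]
    rw [Finset.sum_mul, Finset.mul_sum, Finset.mul_sum]
    refine Finset.sum_congr rfl fun l hl => ?_
    have hlm : l ≤ m := Nat.lt_succ_iff.1 (Finset.mem_range.1 hl)
    rw [if_pos hlm]
    have h3 : ((diskMoment R c (2 * m + 1) : ℂ))⁻¹ * (skewCoeff (diskMoment R c) m l : ℂ) =
      Real.exp (c * R ^ 2) * ((R : ℂ) ^ (2 * m + 2 * l + 4))⁻¹ *
        (edgeCoeff (edgeRate R c) m l : ℂ) := by exact_mod_cast congrArg Complex.ofReal (hcoef hlm)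
    calc _ = (((diskMoment R c (2 * m + 1) : ℂ))⁻¹ * (skewCoeff (diskMoment R c) m l : ℂ)) *
          ((s * (R * X)) ^ (2 * l) * (s * (R * Y)) ^ (2 * m + 1)) := by ring
      _ = _ := by
        rw [h3]
        simp only [mul_pow, pow_succ s, hpow]
        have : (R : ℂ) ^ (2 * m + 2 * l + 4) = R ^ (2 * l) * R ^ (2 * m + 1) * R ^ 3 := by ring
        rw [this]
        field_simp
  unfold diskKernel skewKernel
  simp only [mul_sub, Finset.sum_sub_distrib]
  rw [hhalf X Y, ← hhalf Y X]

end Scaling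

/-! ### The rescaled correlation function and its limit -/

section ScalingLimit
open Filter Topology

lemma diskWeight_scaled {R c M : ℝ} (hR : 0 < R) (hM : M ≠ 0) {s z : ℂ} (hs : ‖s‖ = 1)
    (hz : ‖1 + z / M‖ ≤ 1) :
    (diskWeight R c (s * (R * (1 + z / M))) : ℂ) =
      Complex.exp (-(c * R ^ 2)) * (Complex.exp (-(c * R ^ 2 / M * z)) *
        Complex.exp (-(c * R ^ 2 / M * conj z))) *
        Complex.exp (-(c * R ^ 2 / M ^ 2 * (z * conj z))) := by
  have hn : ‖s * (R * (1 + z / M))‖ = R * ‖1 + z / M‖ := by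
    rw [norm_mul, norm_mul, hs, one_mul, Complex.norm_real, Real.norm_of_nonneg hR.le]
  have hmem : s * (R * (1 + z / M)) ∈ Metric.closedBall (0 : ℂ) R := by
    rw [mem_closedBall_zero_iff, hn]
    nlinarith
  have hM' : (M : ℂ) ≠ 0 := by exact_mod_cast hM
  rw [diskWeight, Set.indicator_of_mem hmem, hn, Complex.ofReal_exp, ← Complex.exp_add,
    ← Complex.exp_add, ← Complex.exp_add]
  congr 1
  have h2 : ((‖1 + z / M‖ : ℝ) : ℂ) ^ 2 = (1 + z / M) * (1 + conj z / M) := by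
    rw [← Complex.mul_conj']
    simp
  push_cast
  rw [mul_pow, h2]
  field_simp
  ring

lemma conjPair_scaled {k : ℕ} {s : ℂ} (hs : conj s = s) (R M : ℝ) (z : Fin k → ℂ)
    (a : Fin k × Fin 2) :
    conjPair (fun j => s * (R * (1 + z j / M))) a = s * (R * (1 + conjPair z a / M)) := by
  obtain ⟨j, i⟩ := a
  fin_cases i <;> simp [conjPair, hs]

/-- With `M = N (1 - ρ²)` the points are `± R (1 + z_j / M)`. Expanding `|1 + z/M|²` in the weight
gives a constant cancelling the prefactor of the kernel, linear exponentials to be absorbed into the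
Pfaffian, and a quadratic term tending to `1`. -/
lemma rescaledCorrelation_eq {ρ : ℝ} (hρ : ρ ∈ Set.Ioo (0 : ℝ) 1) {p θ : ℝ}
    (hp : p = √2 * ρ ∨ p = -(√2 * ρ))
    (hθ : Complex.exp (θ * Complex.I) = (p : ℂ) / (|p| : ℝ)) {N k : ℕ} (hN : 0 < N) (hk : k ≤ N)
    (z : Fin k → ℂ) (hz : ∀ j, ‖1 + z j / ((N * (1 - ρ ^ 2) : ℝ) : ℂ)‖ ≤ 1) :
    (rescaledCorrelation (hardEdgePotential ρ) p θ (hardEdgeScale ρ N) N k z : ℂ) =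
      (∏ j, (conj (z j) - z j)) *
      (∏ j, Complex.exp (-(2 * ρ ^ 2 / (1 - ρ ^ 2) / (N * (1 - ρ ^ 2)) * (z j * conj (z j))))) *
      pfaffian (Matrix.of fun a b => (1 / 2 * (1 / (N * (1 - ρ ^ 2) : ℂ)) ^ 3) *
        (Complex.exp (-(2 * ρ ^ 2 / (1 - ρ ^ 2) * conjPair z a)) *
          Complex.exp (-(2 * ρ ^ 2 / (1 - ρ ^ 2) * conjPair z b))) *
        (edgeSum N (edgeRate (√2 * ρ) N) (1 + conjPair z a / (N * (1 - ρ ^ 2) : ℝ))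
            (1 + conjPair z b / (N * (1 - ρ ^ 2) : ℝ)) -
          edgeSum N (edgeRate (√2 * ρ) N) (1 + conjPair z b / (N * (1 - ρ ^ 2) : ℝ))
            (1 + conjPair z a / (N * (1 - ρ ^ 2) : ℝ)))) := by
  obtain ⟨h0, h1⟩ := hρ
  have hκ : 0 < 1 - ρ ^ 2 := by nlinarith
  have hN' : (0 : ℝ) < N := by exact_mod_cast hN
  set R := √2 * ρ with hR
  have hR0 : 0 < R := by positivity
  have hR2 : R ^ 2 = 2 * ρ ^ 2 := by rw [hR, mul_pow, Real.sq_sqrt (by norm_num)]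
  set M : ℝ := N * (1 - ρ ^ 2) with hM
  have hM0 : 0 < M := by positivity
  have hMc : (M : ℂ) ≠ 0 := by exact_mod_cast hM0.ne'
  have hRc : (R : ℂ) ≠ 0 := by exact_mod_cast hR0.ne'
  have hNc : (N : ℂ) ≠ 0 := by exact_mod_cast hN.ne'
  have hκc : (1 - (ρ : ℂ) ^ 2) ≠ 0 := by exact_mod_cast hκ.ne'
  have hMe : (M : ℂ) = N * (1 - ρ ^ 2) := by rw [hM]; push_cast; ring
  -- As `p` is real, `e^{iθ}` is a sign; hence conjugating `ζ_j` amounts to conjugating `z_j`.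
  obtain ⟨s, hs, hs1⟩ : ∃ s : ℂ, (s = 1 ∨ s = -1) ∧ (p : ℂ) = s * R ∧
      Complex.exp (θ * Complex.I) = s := by
    rcases hp with rfl | rfl
    · exact ⟨1, .inl rfl, by simp, by rw [hθ, abs_of_pos hR0, div_self hRc]⟩
    · refine ⟨-1, .inr rfl, by simp, ?_⟩
      rw [hθ, abs_neg, abs_of_pos hR0]
      push_cast
      rw [neg_div, div_self hRc]
  have hss : s * s = 1 := by rcases hs with rfl | rfl <;> simp
  have hsc : conj s = s := by rcases hs with rfl | rfl <;> simp
  have hsn : ‖s‖ = 1 := by rcases hs with rfl | rfl <;> simp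
  have hγ : hardEdgeScale ρ N = R / M := rfl
  have hζ : (fun j => (p : ℂ) + Complex.exp (θ * Complex.I) * (hardEdgeScale ρ N : ℂ) * z j) =
      fun j => s * (R * (1 + z j / M)) := by
    funext j
    rw [hs1.1, hs1.2, hγ]
    push_cast
    field_simp
  rw [rescaledCorrelation, hζ]
  push_cast
  rw [correlation_eq_pfaffian h0 hN hk]
  simp only [conjPair_scaled hsc, ← hR]
  have hA : (Matrix.of fun a b => diskKernel R N N (s * (R * (1 + conjPair z a / M)))
        (s * (R * (1 + conjPair z b / M)))) =
      Matrix.of fun a b => (-(Real.exp (N * R ^ 2) * ((R : ℂ) ^ 3)⁻¹ * s)) * (1 * 1) *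
        (Matrix.of fun a b : Fin k × Fin 2 =>
          edgeSum N (edgeRate R N) (1 + conjPair z a / M) (1 + conjPair z b / M) -
          edgeSum N (edgeRate R N) (1 + conjPair z b / M) (1 + conjPair z a / M)) a b := by
    ext a b
    rw [Matrix.of_apply, diskKernel_scaled hR0 N N hss]
    simp only [Matrix.of_apply]
    ring
  have hB := pfaffian_scale (Matrix.of fun a b : Fin k × Fin 2 =>
          edgeSum N (edgeRate R N) (1 + conjPair z a / M) (1 + conjPair z b / M) -
          edgeSum N (edgeRate R N) (1 + conjPair z b / M) (1 + conjPair z a / M))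
    (fun a => Complex.exp (-(2 * ρ ^ 2 / (1 - ρ ^ 2) * conjPair z a)))
    (1 / 2 * (1 / (N * (1 - ρ ^ 2) : ℂ)) ^ 3)
  simp only [Matrix.of_apply] at hB
  rw [hA, pfaffian_scale _ (fun _ => 1), hB]
  simp only [diskWeight_scaled hR0 hM0.ne' hsn (hz _)]
  simp only [mul_one, Finset.prod_const_one, ← mul_assoc]
  congr 1
  have hpk : ∀ x : ℂ, x ^ k = ∏ _j : Fin k, x := fun x => by simp
  rw [pow_mul, hpk, hpk, hpk, hpk]
  simp only [← Finset.prod_mul_distrib]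
  refine Finset.prod_congr rfl fun j _ => ?_
  have hc : ((N : ℂ) : ℂ) * (R : ℂ) ^ 2 / M = 2 * ρ ^ 2 / (1 - ρ ^ 2) := by
    have : (R : ℂ) ^ 2 = 2 * ρ ^ 2 := by exact_mod_cast congrArg Complex.ofReal hR2
    rw [this, hMe]
    field_simp
  have hc2 : ((N : ℂ) : ℂ) * (R : ℂ) ^ 2 / M ^ 2 = 2 * ρ ^ 2 / (1 - ρ ^ 2) / M := by
    rw [← hc]; field_simp
  have hE : (Real.exp (N * R ^ 2) : ℂ) * Complex.exp (-((N : ℂ) * (R : ℂ) ^ 2)) = 1 := by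
    rw [Complex.ofReal_exp, ← Complex.exp_add]
    simp
  have hconj : conj (s * (R : ℂ) * (1 + z j / M)) = s * R * (1 + conj (z j) / M) := by
    simp [hsc]
  simp only [Complex.ofReal_natCast]
  rw [hconj, hc, hc2, ← hMe, hγ]
  simp only [conjPair, Matrix.cons_val_zero, Matrix.cons_val_one]
  set e0 := Complex.exp (-(2 * (ρ : ℂ) ^ 2 / (1 - ρ ^ 2) * z j))
  set e1 := Complex.exp (-(2 * (ρ : ℂ) ^ 2 / (1 - ρ ^ 2) * conj (z j)))
  set e2 := Complex.exp (-(2 * (ρ : ℂ) ^ 2 / (1 - ρ ^ 2) / M * z j * conj (z j)))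
  push_cast at hE ⊢
  calc _ = (conj (z j) - z j) * e2 * (1 / 2 * (1 / (M : ℂ)) ^ 3) * e0 * e1 * (s * s) *
        (Complex.exp (N * (R : ℂ) ^ 2) * Complex.exp (-((N : ℂ) * (R : ℂ) ^ 2))) := by
        field_simp
        ring
    _ = _ := by rw [hss, hE]; ring

variable {ι : Type*} {F : Filter ι}

lemma tendsto_pfaffian {n : ℕ} {A : ι → Matrix (Fin n × Fin 2) (Fin n × Fin 2) ℂ}
    {A₀ : Matrix (Fin n × Fin 2) (Fin n × Fin 2) ℂ}
    (h : ∀ a b, Tendsto (fun i => A i a b) F (𝓝 (A₀ a b))) :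
    Tendsto (fun i => pfaffian (A i)) F (𝓝 (pfaffian A₀)) :=
  tendsto_const_nhds.mul (tendsto_finsetSum _ fun _ _ =>
    tendsto_const_nhds.mul (tendsto_finsetProd _ fun _ _ => h _ _))

/-- `|1 + z/M|² = 1 + (2 Re z + |z|²/M) / M`, and the bracket is eventually negative. This both
keeps the points in the disk and dominates the sums. -/
lemma eventually_norm_one_add_div_le {M : ι → ℝ} (hM : Tendsto M F atTop) {z : ι → ℂ} {z₀ : ℂ}
    (hz : Tendsto z F (𝓝 z₀)) (hre : z₀.re < 0) : ∀ᶠ i in F, ‖1 + z i / (M i : ℂ)‖ ≤ 1 := by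
  have h1 : Tendsto (fun i => 2 * (z i).re + ‖z i‖ ^ 2 * (M i)⁻¹) F
      (𝓝 (2 * z₀.re + ‖z₀‖ ^ 2 * 0)) :=
    (((Complex.continuous_re.tendsto _).comp hz).const_mul 2).add
      ((hz.norm.pow 2).mul (tendsto_inv_atTop_zero.comp hM))
  filter_upwards [h1.eventually_lt_const (by linarith : _ < (0 : ℝ)),
    hM.eventually_gt_atTop 0] with i hi hi0
  rw [← sq_le_one_iff₀ (norm_nonneg _), ← Complex.normSq_eq_norm_sq, Complex.normSq_add,
    Complex.normSq_one, Complex.normSq_div, Complex.normSq_ofReal, Complex.normSq_eq_norm_sq]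
  have h2 : ((1 : ℂ) * conj (z i / (M i : ℂ))).re = (z i).re / M i := by
    rw [one_mul, Complex.conj_re, Complex.div_ofReal_re]
  rw [h2]
  have h3 : ‖z i‖ ^ 2 / (M i * M i) + 2 * ((z i).re / M i) =
      (2 * (z i).re + ‖z i‖ ^ 2 * (M i)⁻¹) * (M i)⁻¹ := by
    field_simp
    ring
  have h4 : (2 * (z i).re + ‖z i‖ ^ 2 * (M i)⁻¹) * (M i)⁻¹ ≤ 0 :=
    mul_nonpos_of_nonpos_of_nonneg hi.le (inv_nonneg.2 hi0.le)
  linarith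

/-- The finite-size kernel converges after rescaling, along any admissible family of points. -/
lemma tendsto_scaled_edgeSum [F.IsCountablyGenerated] {N : ι → ℕ} (hN : Tendsto N F atTop)
    {ρ : ℝ} (hρ : ρ ∈ Set.Ioo (0 : ℝ) 1) {z w : ι → ℂ} {z₀ w₀ : ℂ} (hz : Tendsto z F (𝓝 z₀))
    (hw : Tendsto w F (𝓝 w₀)) (hz0 : z₀.re < 0) (hw0 : w₀.re < 0) :
    Tendsto (fun i => (1 / 2 * (1 / (N i * (1 - ρ ^ 2) : ℂ)) ^ 3) *
        (Complex.exp (-(2 * ρ ^ 2 / (1 - ρ ^ 2) * z i)) *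
          Complex.exp (-(2 * ρ ^ 2 / (1 - ρ ^ 2) * w i))) *
        edgeSum (N i) (edgeRate (√2 * ρ) (N i)) (1 + z i / (N i * (1 - ρ ^ 2) : ℝ))
            (1 + w i / (N i * (1 - ρ ^ 2) : ℝ))) F (𝓝 (edgeLimit z₀ w₀)) := by
  have h0 := hρ.1
  have hκ : 0 < 1 - ρ ^ 2 := by nlinarith [hρ.1, hρ.2]
  have hκc : (1 - (ρ : ℂ) ^ 2) ≠ 0 := by exact_mod_cast hκ.ne'
  have hR0 : 0 < √2 * ρ := by positivity
  have hR2 : (√2 * ρ) ^ 2 = 2 * ρ ^ 2 := by rw [mul_pow, Real.sq_sqrt (by norm_num)]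
  have hM : Tendsto (fun i => (N i * (1 - ρ ^ 2) : ℝ)) F atTop :=
    (tendsto_natCast_atTop_atTop.comp hN).atTop_mul_const hκ
  have hb : ∀ i, IsEdgeSeq (N i * (2 * ρ ^ 2)) (edgeRate (√2 * ρ) (N i)) := fun i => by
    rw [← hR2]; exact isEdgeSeq_edgeRate hR0 (Nat.cast_nonneg _)
  have hpos : ∀ᶠ i in F, 0 < N i := hN.eventually_gt_atTop 0
  have hmul : ∀ {z : ι → ℂ} {z₀ : ℂ}, Tendsto z F (𝓝 z₀) →
      Tendsto (fun i => (N i : ℂ) * (z i / (N i * (1 - ρ ^ 2) : ℝ))) F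
        (𝓝 (z₀ / (1 - ρ ^ 2))) := by
    intro z z₀ hz
    refine (hz.div_const _).congr' ?_
    filter_upwards [hpos] with i hi
    have : (N i : ℂ) ≠ 0 := by exact_mod_cast hi.ne'
    push_cast
    field_simp
  have h := tendsto_edgeSum hN (by positivity) hb (hmul hz) (hmul hw)
    (eventually_norm_one_add_div_le hM hz hz0) (eventually_norm_one_add_div_le hM hw hw0)
  rw [integral_edge_eq hρ] at h
  have hexp : ∀ {z : ι → ℂ} {z₀ : ℂ}, Tendsto z F (𝓝 z₀) →
      Tendsto (fun i => Complex.exp (-(2 * ρ ^ 2 / (1 - ρ ^ 2) * z i))) F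
        (𝓝 (Complex.exp (-(2 * ρ ^ 2 / (1 - ρ ^ 2) * z₀)))) := fun hz =>
    (Complex.continuous_exp.tendsto _).comp (hz.const_mul _).neg
  have h2 := (((hexp hz).mul (hexp hw)).const_mul (1 / 2 * (1 / (1 - (ρ : ℂ) ^ 2)) ^ 3)).mul h
  -- The linear Boltzmann exponentials undo those created by shifting the integration variable by
  -- `ρ²`.
  have hlim : 1 / 2 * (1 / (1 - (ρ : ℂ) ^ 2)) ^ 3 *
      (Complex.exp (-(2 * ρ ^ 2 / (1 - ρ ^ 2) * z₀)) *
        Complex.exp (-(2 * ρ ^ 2 / (1 - ρ ^ 2) * w₀))) *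
      (2 * (1 - ρ ^ 2) ^ 3 * (Complex.exp (2 * ρ ^ 2 / (1 - ρ ^ 2) * z₀) *
        Complex.exp (2 * ρ ^ 2 / (1 - ρ ^ 2) * w₀)) * edgeLimit z₀ w₀) = edgeLimit z₀ w₀ := by
    rw [Complex.exp_neg, Complex.exp_neg]
    have e1 := Complex.exp_ne_zero (2 * ρ ^ 2 / (1 - ρ ^ 2) * z₀)
    have e2 := Complex.exp_ne_zero (2 * ρ ^ 2 / (1 - ρ ^ 2) * w₀)
    field_simp
  rw [hlim] at h2
  refine h2.congr' ?_
  filter_upwards [hpos] with i hi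
  have : (N i : ℂ) ≠ 0 := by exact_mod_cast hi.ne'
  rw [one_div_mul_eq_div, ← div_div, div_pow (1 / (N i : ℂ))]
  field_simp

lemma tendsto_hardEdgeKernel {z w : ι → ℂ} {z₀ w₀ : ℂ} (hz : Tendsto z F (𝓝 z₀))
    (hw : Tendsto w F (𝓝 w₀)) :
    Tendsto (fun i => hardEdgeKernel (z i) (w i)) F (𝓝 (hardEdgeKernel z₀ w₀)) := by
  have h : ContinuousAt (fun p : ℂ × ℂ => hardEdgeKernel p.1 p.2) (z₀, w₀) :=
    continuous_hardEdgeKernel.continuousAt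
  have h' := hz.prodMk_nhds hw
  have h'' := Tendsto.comp h h'
  exact h''

lemma pfaffianCorrelation_eq (κ : ℂ → ℂ → ℂ) (k : ℕ) (z : Fin k → ℂ) :
    pfaffianCorrelation κ k z = (∏ j, (conj (z j) - z j)) *
      pfaffian (Matrix.of fun a b => κ (conjPair z a) (conjPair z b)) := by
  unfold pfaffianCorrelation
  congr 2
  ext ⟨j, i⟩ ⟨l, i'⟩
  fin_cases i <;> fin_cases i' <;> simp [conjPair]

end ScalingLimit
end SymplecticEnsemble
end

/-! ### Locally uniform convergence -/

open SymplecticEnsemble Filter Topology ComplexConjugate in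
theorem mainTheorem4 (ρ : ℝ) (hρ : ρ ∈ Set.Ioo (0 : ℝ) 1) (p θ : ℝ)
    (hp : p = √2 * ρ ∨ p = -(√2 * ρ))
    (hθ : Complex.exp (θ * Complex.I) = (p : ℂ) / (|p| : ℝ)) (k : ℕ) :
    TendstoLocallyUniformlyOn
      (fun (N : ℕ) (z : Fin k → ℂ) =>
        ((SymplecticEnsemble.rescaledCorrelation (SymplecticEnsemble.hardEdgePotential ρ) p θ
          (SymplecticEnsemble.hardEdgeScale ρ N) N k z : ℝ) : ℂ))
      (SymplecticEnsemble.pfaffianCorrelation SymplecticEnsemble.hardEdgeKernel k)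
      Filter.atTop
      {z : Fin k → ℂ | ∀ j, (z j).re < 0} := by
  -- It suffices that the limit function and the rescaled correlations tend to the same value along
  -- `atTop ×ˢ 𝓝[S] z₀`; the former is continuity of the kernel.
  rw [tendstoLocallyUniformlyOn_iff_forall_tendsto]
  intro z₀ hz₀
  set S := {z : Fin k → ℂ | ∀ j, (z j).re < 0}
  set F : Filter (ℕ × (Fin k → ℂ)) := atTop ×ˢ 𝓝[S] z₀ with hF
  have hN : Tendsto (fun y : ℕ × (Fin k → ℂ) => y.1) F atTop := tendsto_fst
  have hz : ∀ j, Tendsto (fun y : ℕ × (Fin k → ℂ) => y.2 j) F (𝓝 (z₀ j)) := fun j =>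
    ((continuous_apply j).tendsto z₀).comp (tendsto_snd.mono_right nhdsWithin_le_nhds)
  have hconj : ∀ j, Tendsto (fun y : ℕ × (Fin k → ℂ) => conj (y.2 j)) F (𝓝 (conj (z₀ j))) :=
    fun j => (Complex.continuous_conj.tendsto _).comp (hz j)
  have hpair : ∀ a, Tendsto (fun y : ℕ × (Fin k → ℂ) => conjPair y.2 a) F
      (𝓝 (conjPair z₀ a)) := by
    rintro ⟨j, i⟩
    fin_cases i
    · exact hz j
    · exact hconj j
  have hre : ∀ a, (conjPair z₀ a).re < 0 := by
    rintro ⟨j, i⟩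
    fin_cases i
    · exact hz₀ j
    · exact hz₀ j
  have hκ : 0 < 1 - ρ ^ 2 := by nlinarith [hρ.1, hρ.2]
  have hM : Tendsto (fun y : ℕ × (Fin k → ℂ) => (y.1 * (1 - ρ ^ 2) : ℝ)) F atTop :=
    (tendsto_natCast_atTop_atTop.comp hN).atTop_mul_const hκ
  have hprod : Tendsto (fun y : ℕ × (Fin k → ℂ) => ∏ j, (conj (y.2 j) - y.2 j)) F
      (𝓝 (∏ j, (conj (z₀ j) - z₀ j))) :=
    tendsto_finsetProd _ fun j _ => (hconj j).sub (hz j)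
  have h1 : Tendsto (fun y : ℕ × (Fin k → ℂ) => pfaffianCorrelation hardEdgeKernel k y.2) F
      (𝓝 (pfaffianCorrelation hardEdgeKernel k z₀)) := by
    simp only [pfaffianCorrelation_eq]
    exact hprod.mul (tendsto_pfaffian fun a b => tendsto_hardEdgeKernel (hpair a) (hpair b))
  have h2 : Tendsto (fun y : ℕ × (Fin k → ℂ) =>
      ((rescaledCorrelation (hardEdgePotential ρ) p θ (hardEdgeScale ρ y.1) y.1 k y.2 : ℝ) : ℂ)) F
      (𝓝 (pfaffianCorrelation hardEdgeKernel k z₀)) := by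
    have hgauge : Tendsto (fun y : ℕ × (Fin k → ℂ) => ∏ j,
        Complex.exp (-(2 * ρ ^ 2 / (1 - ρ ^ 2) / (y.1 * (1 - ρ ^ 2)) * (y.2 j * conj (y.2 j)))))
        F (𝓝 (∏ _j : Fin k, 1)) := by
      refine tendsto_finsetProd _ fun j _ => ?_
      have hinv : Tendsto (fun y : ℕ × (Fin k → ℂ) => (((y.1 * (1 - ρ ^ 2) : ℝ)⁻¹ : ℝ) : ℂ)) F
          (𝓝 ((0 : ℝ) : ℂ)) :=
        (Complex.continuous_ofReal.tendsto 0).comp (tendsto_inv_atTop_zero.comp hM)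
      have h3 := (((hinv.const_mul (2 * (ρ : ℂ) ^ 2 / (1 - ρ ^ 2))).mul
        ((hz j).mul (hconj j))).neg)
      rw [Complex.ofReal_zero, mul_zero, zero_mul, neg_zero] at h3
      have h4 := (Complex.continuous_exp.tendsto 0).comp h3
      rw [Complex.exp_zero] at h4
      refine h4.congr fun y => ?_
      simp only [Function.comp_apply]
      push_cast
      rw [div_eq_mul_inv (_ / _)]
    have hpf := (hprod.mul hgauge).mul (tendsto_pfaffian (A₀ := Matrix.of fun a b =>
      hardEdgeKernel (conjPair z₀ a) (conjPair z₀ b)) (A := fun y : ℕ × (Fin k → ℂ) =>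
      Matrix.of fun a b => (1 / 2 * (1 / (y.1 * (1 - ρ ^ 2) : ℂ)) ^ 3) *
        (Complex.exp (-(2 * ρ ^ 2 / (1 - ρ ^ 2) * conjPair y.2 a)) *
          Complex.exp (-(2 * ρ ^ 2 / (1 - ρ ^ 2) * conjPair y.2 b))) *
        (edgeSum y.1 (edgeRate (√2 * ρ) y.1) (1 + conjPair y.2 a / (y.1 * (1 - ρ ^ 2) : ℝ))
            (1 + conjPair y.2 b / (y.1 * (1 - ρ ^ 2) : ℝ)) -
          edgeSum y.1 (edgeRate (√2 * ρ) y.1) (1 + conjPair y.2 b / (y.1 * (1 - ρ ^ 2) : ℝ))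
            (1 + conjPair y.2 a / (y.1 * (1 - ρ ^ 2) : ℝ)))) fun a b => by
        simp only [Matrix.of_apply, hardEdgeKernel_eq]
        refine ((tendsto_scaled_edgeSum hN hρ (hpair a) (hpair b) (hre a) (hre b)).sub
          (tendsto_scaled_edgeSum hN hρ (hpair b) (hpair a) (hre b) (hre a))).congr fun y => ?_
        ring)
    rw [Finset.prod_const_one, mul_one, ← pfaffianCorrelation_eq] at hpf
    refine hpf.congr' ?_
    -- The Pfaffian formula needs `0 < N`, `k ≤ N` and all points in the disk, which hold only
    -- eventually.
    filter_upwards [hN.eventually_gt_atTop 0, hN.eventually_ge_atTop k,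
      eventually_all.2 fun j => eventually_norm_one_add_div_le hM (hz j) (hz₀ j)] with y hy hk hy1
    exact (rescaledCorrelation_eq hρ hp hθ hy hk y.2 hy1).symm
  exact (h1.prodMk_nhds h2).mono_right (nhds_le_uniformity _)
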